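/- **Setting.** Let $\Delta^2=\{(t_0,t_1)\in[0,1]^2: t_0+t_1=1\}$. A (binary) classification problem $X$ is a probability space $(X,\mu_X)$ with a measurable conditional label distribution $p_X=(p_X(y_0\mid\cdot),p_X(y_1\mid\cdot)):X\to\Delta^2$ whose law $\mu_X\circ p_X^{-1}$ is absolutely continuous with respect to Lebesgue measure on $\Delta^2$. A decision is a measurable map $d=(d_0,d_1):X\to\Delta^2$; its confusion matrix is $M_X(d)_{ij}=\int_X d_j\,p_X(y_i\mid\cdot)\,d\mu_X$, with diagonal $(\mathrm{tnr}(d),\mathrm{tpr}(d))$, and $\mathrm{IPS}(X)\subseteq[0,1]^2$ is the set of all these diagonals. Write $d\precsim d'$ if $\mathrm{tnr}(d)\le\mathrm{tnr}(d')$ and $\mathrm{tpr}(d)\le\mathrm{tpr}(d')$, and $d\prec d'$ if $d\precsim d'$ but not $d'\precsim d$; $d$ is Pareto maximal if $d\precsim d'$ implies $d'\precsim d$. Let $\Delta_X$ be the classification problem on $\Delta^2$ with the law of $p_X$ as its measure and the identity as its conditional distribution. A measurable $A\subseteq X$ with $\mu_X(A)>0$ is a classification problem with $\mu_X(\cdot\mid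 A)$ and $p_X|_A$. Let $X$ be partitioned into two measurable sensitive groups $F,M$ of positive measure. A decision $d$ on $X$ does not cherry-pick if, for each $A\in\{F,M\}$ and almost all $x,x'\in A$: if $p_X(y_1\mid x)\le p_X(y_1\mid x')$ then $P(\widehat Y(x')=0\mid\widehat Y(x)=1)=0$, where $\widehat Y(x)\sim d(x)$ and $\widehat Y(x')\sim d(x')$ are sampled independently (the condition is void if $d_1(x)=0$). An evaluation metric is a real-valued function $\ell(d,X)$ of a classification problem and a decision on it such that $d\precsim d'$ implies $\ell(d,X)\le\ell(d',X)$, and $\ell(d\circ p_X,X)=\ell(d,\Delta_X)$ for all decisions $d$ on $\Delta^2$. A fairness measure is a non-negative function $\mathcal F(d_F,d_M,F,M)$ of two classification problems and a decision on each, which depends on $d_F,d_M$ only through their confusion matrices and satisfies $\mathcal F(d_F\circ p_F,d_M\circ p_M,F,M)=\mathcal F(d_F,d_M,\Delta_F,\Delta_M)$ for decisions $d_F,d_M$ on $\Delta^2$. There are functions $\hat\ell,\widehat{\mathcal F}$ with $\ell(d,X)=\hat\ell(\mathrm{tnr}(d),\mathrm{tpr}(d),\mathrm{IPS}(X))$ and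 $$\mathcal F(d_F,d_M,F,M)=\widehat{\mathcal F}(\mathrm{tnr}(d_F),\mathrm{tpr}(d_F),\mathrm{IPS}(F),\mathrm{tnr}(d_M),\mathrm{tpr}(d_M),\mathrm{IPS}(M)),$$ uniquely determined at the attainable arguments $(t,t',E)$, i.e. those where $E$ is the IPS of a classification problem and $(t,t')\in E$. $\ell$ (resp. $\mathcal F$) is continuous if $\hat\ell$ (resp. $\widehat{\mathcal F}$) is jointly continuous at the attainable arguments, the distance of two sets being the Lebesgue measure of their symmetric difference. $\mathcal F$ is smooth if it is continuous and, for all classification problems $F,M$, $\widehat{\mathcal F}(\cdot,\cdot,\mathrm{IPS}(F),\cdot,\cdot,\mathrm{IPS}(M))$ is continuously differentiable on $\mathrm{IPS}(F)\times\mathrm{IPS}(M)$. **Theorem.** Let $X$ be a binary classification problem partitioned into sensitive groups $F,M$ as above, and let $\mathcal F$ be a smooth fairness measure such that for each $A\in\{F,M\}$ $$\min\left(\frac{\partial\widehat{\mathcal F}}{\partial t_A},\frac{\partial\widehat{\mathcal F}}{\partial t'_A}\right)\le 0$$ at all points $(t_F,t'_F,\mathrm{IPS}(F),t_M,t'_M,\mathrm{IPS}(M))$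 with $(t_F,t'_F)$ in the interior of $\mathrm{IPS}(F)$ and $(t_M,t'_M)$ in the interior of $\mathrm{IPS}(M)$. 1. If $d$ is a decision on $X$ whose restriction to some group $A\in\{F,M\}$ is not Pareto maximal, then there is a decision $\widehat d\succ d$ on $X$ with $\mathcal F(\widehat d|_F,\widehat d|_M,F,M)\le\mathcal F(d|_F,d|_M,F,M)$. 2. In particular, for every continuous evaluation metric $\ell$ there is a decision $$\overline d\in\arg\max_{d:X\to\Delta^2}\ \ell(d,X)-\mathcal F(d|_F,d|_M,F,M)$$ that does not cherry-pick. -/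

import Mathlib

open MeasureTheory Set
open scoped ENNReal

universe u

noncomputable section

namespace CherryPick

/-- The simplex `Δ² = {(t₀, t₁) ∈ [0,1]² : t₀ + t₁ = 1}`. -/
abbrev Simplex : Type := stdSimplex ℝ (Fin 2)

/-- Lebesgue measure on the segment `Δ²`: the image of Lebesgue measure on `[0,1]` under the
parametrisation `s ↦ (1 - s, s)`. -/
def simplexVolume : Measure Simplex :=
  (volume : Measure unitInterval).map stdSimplexHomeomorphUnitInterval.symm

/-- A binary classification problem with labels `{0, 1}`: a probability space of individuals with a
measurable conditional label distribution `p x = (p(y₀ | x), p(y₁ | x)) ∈ Δ²` whose law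
`μ_Δ = μ ∘ p⁻¹` is absolutely continuous with respect to Lebesgue measure on `Δ²`. -/
structure Problem : Type (u + 1) where
  carrier : Type u
  [mspace : MeasurableSpace carrier]
  μ : Measure carrier
  [prob : IsProbabilityMeasure μ]
  p : carrier → Simplex
  measurable_p : Measurable p
  absolutelyContinuous : μ.map p ≪ simplexVolume

attribute [instance] Problem.mspace Problem.prob

namespace Problem

/-- A (probabilistic) decision: a measurable map `d : X → Δ²`. -/
abbrev Decision (P : Problem.{u}) : Type u := {d : P.carrier → Simplex // Measurable d}

/-- The confusion matrix, with entries `P(Ŷ = j, Y = i)`. -/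
def confusion (P : Problem.{u}) (d : P.Decision) : Matrix (Fin 2) (Fin 2) ℝ :=
  Matrix.of fun i j => ∫ x, (d.1 x : Fin 2 → ℝ) j * (P.p x : Fin 2 → ℝ) i ∂P.μ

/-- The diagonal of the confusion matrix: entry `0` is the probability `tnr d = P(Ŷ = 0, Y = 0)`
of a true negative, entry `1` the probability `tpr d = P(Ŷ = 1, Y = 1)` of a true positive. -/
def rates (P : Problem.{u}) (d : P.Decision) : Fin 2 → ℝ := (P.confusion d).diag

/-- The individual pieces set: all diagonals of confusion matrices. -/
def IPS (P : Problem.{u}) : Set (Fin 2 → ℝ) := Set.range P.rates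

/-- The Pareto pre-order `d ≾ d'`. -/
def ParetoLE (P : Problem.{u}) (d d' : P.Decision) : Prop :=
  ∀ i, P.confusion d i i ≤ P.confusion d' i i

/-- The strict part `d ≺ d'` of the Pareto pre-order. -/
def ParetoLT (P : Problem.{u}) (d d' : P.Decision) : Prop :=
  P.ParetoLE d d' ∧ ¬ P.ParetoLE d' d

def ParetoMaximal (P : Problem.{u}) (d : P.Decision) : Prop :=
  ∀ d' : P.Decision, P.ParetoLE d d' → P.ParetoLE d' d

/-- The classification problem `Δ_X` on the simplex: the measure is the law of `p` and the
conditional distribution is the identity (`ULift` only moves `Δ²` to the universe of `X`). -/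
def onSimplex (P : Problem.{u}) : Problem.{u} where
  carrier := ULift.{u} Simplex
  μ := P.μ.map fun x => ULift.up (P.p x)
  prob := Measure.isProbabilityMeasure_map
    (measurable_up.comp P.measurable_p).aemeasurable
  p := ULift.down
  measurable_p := measurable_down
  absolutelyContinuous := by
    have h := Measure.map_map (μ := P.μ) measurable_down (measurable_up.{0, u}.comp P.measurable_p)
    change Measure.map ULift.down (Measure.map (ULift.up ∘ P.p) P.μ) ≪ _
    rw [h]
    exact P.absolutelyContinuous

/-- The decision `d ∘ p` on `X` induced by a decision `d` on the simplex. -/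
def pullback (P : Problem.{u}) (d : P.onSimplex.Decision) : P.Decision :=
  ⟨fun x => d.1 (ULift.up (P.p x)), d.2.comp (measurable_up.comp P.measurable_p)⟩

/-- A measurable subset `A` of positive measure as a classification problem of its own, with the
conditional probability measure `μ(· | A)` and the restriction of `p`. -/
def restrict (P : Problem.{u}) (A : Set P.carrier) (hA : MeasurableSet A) (h0 : P.μ A ≠ 0) :
    Problem.{u} where
  carrier := A
  μ := (ProbabilityTheory.cond P.μ A).comap Subtype.val
  prob := by
    have := ProbabilityTheory.cond_isProbabilityMeasure (μ := P.μ) h0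
    refine ⟨?_⟩
    rw [(MeasurableEmbedding.subtype_coe hA).comap_apply, image_univ, Subtype.range_coe,
      ProbabilityTheory.cond_apply_self h0 (measure_ne_top _ _)]
  p := fun x => P.p x
  measurable_p := P.measurable_p.comp measurable_subtype_coe
  absolutelyContinuous := by
    change Measure.map (P.p ∘ Subtype.val) _ ≪ _
    rw [← Measure.map_map P.measurable_p measurable_subtype_coe, map_comap_subtype_coe hA]
    exact ((Measure.restrict_le_self.absolutelyContinuous.trans
      ProbabilityTheory.cond_absolutelyContinuous).map P.measurable_p).trans
      P.absolutelyContinuous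

/-- The restricted decision `d|_A`. -/
def restrictDecision (P : Problem.{u}) (d : P.Decision) (A : Set P.carrier)
    (hA : MeasurableSet A) (h0 : P.μ A ≠ 0) : (P.restrict A hA h0).Decision :=
  ⟨fun x => d.1 x.1, d.2.comp measurable_subtype_coe⟩

end Problem

/-- The law on `{0, 1}` of a label sampled from `q ∈ Δ²`. -/
def labelLaw (q : Simplex) : Measure (Fin 2) :=
  ∑ i, ENNReal.ofReal ((q : Fin 2 → ℝ) i) • Measure.dirac i

/-- A partition of the population into two sensitive groups, both of positive measure. -/
structure SensitiveGroups (P : Problem.{u}) where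
  F : Set P.carrier
  M : Set P.carrier
  measurableSet_F : MeasurableSet F
  measurableSet_M : MeasurableSet M
  disjoint : Disjoint F M
  union_eq : F ∪ M = Set.univ
  measure_F_ne_zero : P.μ F ≠ 0
  measure_M_ne_zero : P.μ M ≠ 0

namespace SensitiveGroups

variable {P : Problem.{u}}

/-- The group `F` as a classification problem. -/
abbrev problemF (G : SensitiveGroups P) : Problem.{u} :=
  P.restrict G.F G.measurableSet_F G.measure_F_ne_zero

/-- The group `M` as a classification problem. -/
abbrev problemM (G : SensitiveGroups P) : Problem.{u} :=
  P.restrict G.M G.measurableSet_M G.measure_M_ne_zero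

abbrev decisionF (G : SensitiveGroups P) (d : P.Decision) : G.problemF.Decision :=
  P.restrictDecision d G.F G.measurableSet_F G.measure_F_ne_zero

abbrev decisionM (G : SensitiveGroups P) (d : P.Decision) : G.problemM.Decision :=
  P.restrictDecision d G.M G.measurableSet_M G.measure_M_ne_zero

/-- `d` does not cherry-pick on the population of the problem `Q`: for almost all `x, x'`, if
`p(y₁ | x) ≤ p(y₁ | x')` then `P(Ŷ(x') = 0 | Ŷ(x) = 1) = 0`, where `Ŷ(x)` and `Ŷ(x')` are sampled
independently from `d x` and `d x'` (conditioning on a null event gives the zero measure). -/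
def NoCherryPickOn (Q : Problem.{u}) (d : Q.Decision) : Prop :=
  ∀ᵐ z ∂(Q.μ.prod Q.μ),
    (Q.p z.1 : Fin 2 → ℝ) 1 ≤ (Q.p z.2 : Fin 2 → ℝ) 1 →
      ProbabilityTheory.cond ((labelLaw (d.1 z.1)).prod (labelLaw (d.1 z.2)))
        {y | y.1 = 1} {y | y.2 = 0} = 0

/-- `d` does not cherry-pick: it does not do so inside any of the sensitive groups. -/
def NoCherryPick (G : SensitiveGroups P) (d : P.Decision) : Prop :=
  NoCherryPickOn G.problemF (G.decisionF d) ∧ NoCherryPickOn G.problemM (G.decisionM d)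

end SensitiveGroups

/-- The Fréchet–Nikodym distance of two subsets of the plane. -/
def fnDist (E E' : Set (Fin 2 → ℝ)) : ℝ≥0∞ := volume (E \ E') + volume (E' \ E)

/-- An evaluation metric. -/
structure EvaluationMetric : Type (u + 1) where
  eval : (P : Problem.{u}) → P.Decision → ℝ
  mono : ∀ (P : Problem.{u}) (d d' : P.Decision), P.ParetoLE d d' → eval P d ≤ eval P d'
  invariant : ∀ (P : Problem.{u}) (d : P.onSimplex.Decision),
    eval P (P.pullback d) = eval P.onSimplex d

namespace EvaluationMetric

/-- The function `ℓ̂(t, E)` with `ℓ̂((tnr d, tpr d), IPS X) = ℓ(d, X)`. Its values at other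
arguments are arbitrary. -/
def hat (l : EvaluationMetric.{u}) (t : Fin 2 → ℝ) (E : Set (Fin 2 → ℝ)) : ℝ :=
  Classical.epsilon fun v : ℝ => ∃ (P : Problem.{u}) (d : P.Decision),
    P.rates d = t ∧ P.IPS = E ∧ l.eval P d = v

/-- `ℓ̂` is jointly continuous in all its variables, at the attainable arguments (`E` the IPS of a
problem, `t ∈ E`), where `ℓ` determines it. -/
def IsContinuous (l : EvaluationMetric.{u}) : Prop :=
  ∀ (P : Problem.{u}), ∀ t ∈ P.IPS, ∀ ε > (0 : ℝ), ∃ δ > (0 : ℝ),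
    ∀ (P' : Problem.{u}), ∀ t' ∈ P'.IPS,
      dist t' t < δ → fnDist P'.IPS P.IPS < ENNReal.ofReal δ →
        |l.hat t' P'.IPS - l.hat t P.IPS| < ε

end EvaluationMetric

/-- A (group) fairness measure, a function of a decision on each of the two groups and of the two
groups, each of them a classification problem. -/
structure FairnessMeasure : Type (u + 1) where
  val : (P Q : Problem.{u}) → P.Decision → Q.Decision → ℝ
  nonneg : ∀ (P Q : Problem.{u}) (d : P.Decision) (e : Q.Decision), 0 ≤ val P Q d e
  congr_confusion : ∀ (P Q : Problem.{u}) (d d' : P.Decision) (e e' : Q.Decision),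
    P.confusion d = P.confusion d' → Q.confusion e = Q.confusion e' →
      val P Q d e = val P Q d' e'
  invariant : ∀ (P Q : Problem.{u}) (d : P.onSimplex.Decision) (e : Q.onSimplex.Decision),
    val P Q (P.pullback d) (Q.pullback e) = val P.onSimplex Q.onSimplex d e

namespace FairnessMeasure

/-- The function `𝓕̂(t_F, E_F, t_M, E_M)` (with `t_A` short for the pair `(t_A, t'_A)`) such that
`𝓕̂((tnr d, tpr d), IPS P, (tnr e, tpr e), IPS Q) = 𝓕(d, e, P, Q)`. Its values at other arguments
are arbitrary. -/
def hat (f : FairnessMeasure.{u}) (t : Fin 2 → ℝ) (E : Set (Fin 2 → ℝ))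
    (s : Fin 2 → ℝ) (E' : Set (Fin 2 → ℝ)) : ℝ :=
  Classical.epsilon fun v : ℝ =>
    ∃ (P Q : Problem.{u}) (d : P.Decision) (e : Q.Decision),
      P.rates d = t ∧ P.IPS = E ∧ Q.rates e = s ∧ Q.IPS = E' ∧ f.val P Q d e = v

/-- `𝓕̂` is jointly continuous in all its variables, at the attainable arguments. -/
def IsContinuous (f : FairnessMeasure.{u}) : Prop :=
  ∀ (P Q : Problem.{u}), ∀ t ∈ P.IPS, ∀ s ∈ Q.IPS, ∀ ε > (0 : ℝ), ∃ δ > (0 : ℝ),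
    ∀ (P' Q' : Problem.{u}), ∀ t' ∈ P'.IPS, ∀ s' ∈ Q'.IPS,
      dist t' t < δ → fnDist P'.IPS P.IPS < ENNReal.ofReal δ →
      dist s' s < δ → fnDist Q'.IPS Q.IPS < ENNReal.ofReal δ →
        |f.hat t' P'.IPS s' Q'.IPS - f.hat t P.IPS s Q.IPS| < ε

/-- `𝓕` is smooth: `𝓕̂` is continuous, and continuously differentiable in the four real variables
on the set (a convex body) of their attainable values. -/
def IsSmooth (f : FairnessMeasure.{u}) : Prop :=
  f.IsContinuous ∧ ∀ P Q : Problem.{u},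
    ContDiffOn ℝ 1
      (fun z : (Fin 2 → ℝ) × (Fin 2 → ℝ) => f.hat z.1 P.IPS z.2 Q.IPS) (P.IPS ×ˢ Q.IPS)

/-- Partial derivative of `𝓕̂` in the coordinate `i` of the first group
(`∂𝓕̂/∂t_F` for `i = 0`, `∂𝓕̂/∂t'_F` for `i = 1`). -/
def partialF (f : FairnessMeasure.{u}) (i : Fin 2) (t : Fin 2 → ℝ) (E : Set (Fin 2 → ℝ))
    (s : Fin 2 → ℝ) (E' : Set (Fin 2 → ℝ)) : ℝ :=
  deriv (fun r : ℝ => f.hat (Function.update t i r) E s E') (t i)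

/-- Partial derivative of `𝓕̂` in the coordinate `i` of the second group
(`∂𝓕̂/∂t_M` for `i = 0`, `∂𝓕̂/∂t'_M` for `i = 1`). -/
def partialM (f : FairnessMeasure.{u}) (i : Fin 2) (t : Fin 2 → ℝ) (E : Set (Fin 2 → ℝ))
    (s : Fin 2 → ℝ) (E' : Set (Fin 2 → ℝ)) : ℝ :=
  deriv (fun r : ℝ => f.hat t E (Function.update s i r) E') (s i)

/-- `𝓕(d|_F, d|_M, F, M)`. -/
def ofDecision (f : FairnessMeasure.{u}) {P : Problem.{u}} (G : SensitiveGroups P)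
    (d : P.Decision) : ℝ :=
  f.val G.problemF G.problemM (G.decisionF d) (G.decisionM d)

end FairnessMeasure

/-- The solution set `argmax_d ℓ(d, X) - 𝓕(d|_F, d|_M, F, M)` of the fairness problem. -/
def fairnessArgmax (l : EvaluationMetric.{u}) (f : FairnessMeasure.{u}) {P : Problem.{u}}
    (G : SensitiveGroups P) : Set P.Decision :=
  {d | ∀ d' : P.Decision, l.eval P d' - f.ofDecision G d' ≤ l.eval P d - f.ofDecision G d}

end CherryPick

end

namespace CherryPick

noncomputable section

/-! Write `a` for the acceptance probability of a decision and `s` for the score, the probability of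
label 1. Then `tpr = ∫ a s` and `tnr = (1 - ∫ s) - ∫ a + ∫ a s`, so the IPS is the image under an
affine map of the set of `[0,1]`-valued functions, which is convex and weakly compact in `L²`. Every
weighted sum `c tnr + (1 - c) tpr` equals a constant plus `∫ a (s - c)`. It is maximised by
accepting where `s > c`, and only by that up to null sets, since the law of `s` has no atoms. Hence
the IPS determines the law of `s`, which makes `ℓ̂` and `𝓕̂` well defined (`hat_rates`), and Pareto
maximal decisions are thresholds, which do not cherry-pick.

For the first claim, a decision that is not Pareto maximal can be improved in both rates at once
(`exists_gt_of_not_paretoMaximal`), and the box between the two points lies in the IPS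
(`ordConnected_IPS`). At each interior point `𝓕̂` does not increase to first order in some
coordinate direction, so some point of the upper faces of a slightly smaller box has a value no
larger than that at the lower corner (`exists_upperFace_le`). As the hypothesis concerns interior
points only, the lower corner and the rates of the other group are approximated from the interior;
the limit stays on a fixed upper face, hence is a strict improvement
(`exists_gt_le_of_min_deriv_nonpos`).

For the second claim, compactness and continuity give a maximiser, and among the maximisers one with
the largest sum of rates. Were it not Pareto maximal on some group, the first claim would give
another maximiser with a larger sum. So it is a threshold decision on each group. -/

lemma simplex_zero_eq (q : Simplex) : (q : Fin 2 → ℝ) 0 = 1 - (q : Fin 2 → ℝ) 1 := by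
  have h := q.2.2
  rw [Fin.sum_univ_two] at h
  exact eq_sub_of_add_eq h

lemma simplex_one_mem (q : Simplex) : (q : Fin 2 → ℝ) 1 ∈ Icc (0 : ℝ) 1 :=
  (stdSimplexHomeomorphUnitInterval q).2

lemma simplex_ext {q q' : Simplex} (h : (q : Fin 2 → ℝ) 1 = (q' : Fin 2 → ℝ) 1) : q = q' := by
  apply Subtype.ext
  funext i
  fin_cases i
  · change (q : Fin 2 → ℝ) 0 = (q' : Fin 2 → ℝ) 0
    rw [simplex_zero_eq, simplex_zero_eq, h]
  · exact h

/-- The point of the simplex whose second coordinate is `r`, clamped to `[0, 1]`. -/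
def simplexOfReal (r : ℝ) : Simplex :=
  stdSimplexHomeomorphUnitInterval.symm (projIcc 0 1 zero_le_one r)

lemma measurable_simplexOfReal : Measurable simplexOfReal :=
  (stdSimplexHomeomorphUnitInterval.symm.continuous.comp continuous_projIcc).measurable

lemma simplexOfReal_one {r : ℝ} (h : r ∈ Icc (0 : ℝ) 1) :
    (simplexOfReal r : Fin 2 → ℝ) 1 = r := by
  change ((projIcc (0 : ℝ) 1 zero_le_one r : Icc (0 : ℝ) 1) : ℝ) = r
  rw [projIcc_of_mem _ h]

lemma measurable_simplex_apply (i : Fin 2) : Measurable fun q : Simplex => (q : Fin 2 → ℝ) i :=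
  (measurable_pi_apply i).comp measurable_subtype_coe

lemma simplexVolume_level (c : ℝ) : simplexVolume {q | (q : Fin 2 → ℝ) 1 = c} = 0 := by
  have hm : MeasurableSet {q : Simplex | (q : Fin 2 → ℝ) 1 = c} :=
    measurable_simplex_apply 1 (measurableSet_singleton c)
  rw [simplexVolume, Measure.map_apply stdSimplexHomeomorphUnitInterval.symm.continuous.measurable
    hm]
  apply Set.Subsingleton.measure_zero
  intro s hs t ht
  have hs' : (s : ℝ) = c := hs
  have ht' : (t : ℝ) = c := ht
  exact Subtype.ext (hs'.trans ht'.symm)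

/-! ### Rates as affine functionals of the acceptance probability. -/

namespace Problem

variable (P : Problem.{u})

/-- The conditional probability of the label `1`. -/
def score (x : P.carrier) : ℝ := (P.p x : Fin 2 → ℝ) 1

variable {P} in
/-- The probability with which a decision accepts. -/
def Decision.accept (d : P.Decision) (x : P.carrier) : ℝ := (d.1 x : Fin 2 → ℝ) 1

/-- The decision that accepts with the given probability. -/
def decisionOf (g : P.carrier → ℝ) (hg : Measurable g) : P.Decision :=
  ⟨fun x => simplexOfReal (g x), measurable_simplexOfReal.comp hg⟩

variable {P}

lemma accept_decisionOf {g : P.carrier → ℝ} (hg : Measurable g) {x : P.carrier}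
    (h : g x ∈ Icc (0 : ℝ) 1) : Decision.accept (P.decisionOf g hg) x = g x :=
  simplexOfReal_one h

lemma measurable_score : Measurable P.score := (measurable_simplex_apply 1).comp P.measurable_p

lemma score_mem (x : P.carrier) : P.score x ∈ Icc (0 : ℝ) 1 := simplex_one_mem _

lemma measurable_accept (d : P.Decision) : Measurable (Decision.accept d) :=
  (measurable_simplex_apply 1).comp d.2

lemma accept_mem (d : P.Decision) (x : P.carrier) : Decision.accept d x ∈ Icc (0 : ℝ) 1 :=
  simplex_one_mem _

lemma integrable_of_abs_le {g : P.carrier → ℝ} (hg : Measurable g) (C : ℝ)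
    (h : ∀ x, |g x| ≤ C) : Integrable g P.μ :=
  Integrable.of_bound hg.aestronglyMeasurable C (Filter.Eventually.of_forall h)

lemma abs_le_one_of_mem {r : ℝ} (h : r ∈ Icc (0 : ℝ) 1) : |r| ≤ 1 :=
  abs_le.2 ⟨by linarith [h.1], h.2⟩

lemma mul_mem_unit {r s : ℝ} (hr : r ∈ Icc (0 : ℝ) 1) (hs : s ∈ Icc (0 : ℝ) 1) :
    r * s ∈ Icc (0 : ℝ) 1 :=
  ⟨mul_nonneg hr.1 hs.1, mul_le_one₀ hr.2 hs.1 hs.2⟩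

lemma one_sub_mem_unit {r : ℝ} (hr : r ∈ Icc (0 : ℝ) 1) : 1 - r ∈ Icc (0 : ℝ) 1 :=
  ⟨sub_nonneg.2 hr.2, sub_le_self _ hr.1⟩

lemma integrable_score : Integrable P.score P.μ :=
  integrable_of_abs_le measurable_score 1 fun x => abs_le_one_of_mem (score_mem x)

lemma integrable_accept (d : P.Decision) : Integrable (Decision.accept d) P.μ :=
  integrable_of_abs_le (measurable_accept d) 1 fun x => abs_le_one_of_mem (accept_mem d x)

lemma integrable_accept_mul_score (d : P.Decision) :
    Integrable (fun x => Decision.accept d x * P.score x) P.μ :=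
  integrable_of_abs_le ((measurable_accept d).mul measurable_score) 1
    fun x => abs_le_one_of_mem (mul_mem_unit (accept_mem d x) (score_mem x))

lemma rates_one (d : P.Decision) : P.rates d 1 = ∫ x, Decision.accept d x * P.score x ∂P.μ := rfl

lemma rates_zero (d : P.Decision) :
    P.rates d 0 = ∫ x, (1 - Decision.accept d x) * (1 - P.score x) ∂P.μ := by
  change ∫ x, (d.1 x : Fin 2 → ℝ) 0 * (P.p x : Fin 2 → ℝ) 0 ∂P.μ = _
  simp only [simplex_zero_eq]
  rfl

/-- The rates of a decision as integrals that are affine in the acceptance probability. -/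
lemma rates_zero' (d : P.Decision) :
    P.rates d 0 = (1 - ∫ x, P.score x ∂P.μ) - (∫ x, Decision.accept d x ∂P.μ) + P.rates d 1 := by
  rw [rates_zero, rates_one]
  have h1 := integrable_score (P := P)
  have h2 := integrable_accept d
  have h3 := integrable_accept_mul_score d
  have : (fun x => (1 - Decision.accept d x) * (1 - P.score x)) =
      fun x => ((1 - P.score x) - Decision.accept d x) + Decision.accept d x * P.score x := by
    funext x; ring
  have h4 : Integrable (fun x => 1 - P.score x) P.μ := (integrable_const _).sub h1
  have h5 : Integrable (fun x => 1 - P.score x - Decision.accept d x) P.μ := h4.sub h2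
  rw [this, integral_add h5 h3, integral_sub h4 h2, integral_sub (integrable_const _) h1]
  simp

lemma rates_nonneg (d : P.Decision) (i : Fin 2) : 0 ≤ P.rates d i :=
  integral_nonneg fun x => mul_nonneg ((d.1 x).2.1 i) ((P.p x).2.1 i)

/-- Absolute continuity enters the argument here: the score has no atoms, so ties at a threshold are
negligible. -/
lemma measure_score_eq (c : ℝ) : P.μ {x | P.score x = c} = 0 := by
  have h := P.absolutelyContinuous (simplexVolume_level c)
  have hm : MeasurableSet {q : Simplex | (q : Fin 2 → ℝ) 1 = c} :=
    measurable_simplex_apply 1 (measurableSet_singleton c)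
  rwa [Measure.map_apply P.measurable_p hm] at h

lemma ae_score_ne (c : ℝ) : ∀ᵐ x ∂P.μ, P.score x ≠ c := by
  rw [ae_iff]
  simp [measure_score_eq]

/-- Row `i` of the confusion matrix sums to the probability of label `i`, which does not depend on
the decision, so the diagonal determines the other entries. -/
lemma confusion_eq_of_rates_eq {d d' : P.Decision} (h : P.rates d = P.rates d') :
    P.confusion d = P.confusion d' := by
  have key : ∀ (e : P.Decision) (i j : Fin 2), Integrable
      (fun x => (e.1 x : Fin 2 → ℝ) j * (P.p x : Fin 2 → ℝ) i) P.μ := by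
    intro e i j
    refine integrable_of_abs_le (((measurable_simplex_apply j).comp e.2).mul
      ((measurable_simplex_apply i).comp P.measurable_p)) 1 fun x => abs_le_one_of_mem ?_
    have : ∀ (q : Simplex) (k : Fin 2), (q : Fin 2 → ℝ) k ∈ Icc (0 : ℝ) 1 := by
      intro q k
      fin_cases k
      · change (q : Fin 2 → ℝ) 0 ∈ Icc (0 : ℝ) 1
        rw [simplex_zero_eq]
        exact one_sub_mem_unit (simplex_one_mem q)
      · exact simplex_one_mem q
    exact mul_mem_unit (this _ _) (this _ _)
  have row : ∀ (e : P.Decision) (i : Fin 2),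
      P.confusion e i 0 + P.confusion e i 1 = ∫ x, (P.p x : Fin 2 → ℝ) i ∂P.μ := by
    intro e i
    change ∫ x, _ ∂P.μ + ∫ x, _ ∂P.μ = _
    rw [← integral_add (key e i 0) (key e i 1)]
    congr 1
    funext x
    rw [simplex_zero_eq (e.1 x)]
    ring
  have h0 : P.confusion d 0 0 = P.confusion d' 0 0 := congrFun h 0
  have h1 : P.confusion d 1 1 = P.confusion d' 1 1 := congrFun h 1
  ext i j
  fin_cases i <;> fin_cases j
  · exact h0
  · have := row d 0; have := row d' 0
    change P.confusion d 0 1 = P.confusion d' 0 1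
    linarith
  · have := row d 1; have := row d' 1
    change P.confusion d 1 0 = P.confusion d' 1 0
    linarith
  · exact h1

lemma paretoLE_iff {d d' : P.Decision} : P.ParetoLE d d' ↔ P.rates d ≤ P.rates d' := Iff.rfl

/-! ### Threshold decisions -/

variable (P) in
/-- The decision that accepts exactly the individuals of score above `c`. -/
def threshold (c : ℝ) : P.Decision :=
  P.decisionOf ({x | c < P.score x}.indicator 1)
    (measurable_one.indicator (measurable_score measurableSet_Ioi))

lemma accept_threshold (c : ℝ) (x : P.carrier) :
    Decision.accept (P.threshold c) x = {x | c < P.score x}.indicator 1 x := by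
  apply accept_decisionOf
  by_cases h : x ∈ {x | c < P.score x} <;> simp [h]

/-- Turns a linear functional of the rates into one integral whose integrand can be maximised
pointwise. No sign condition on `c` or `1 - c` is needed. -/
lemma weighted_rates (d : P.Decision) (c : ℝ) :
    c * P.rates d 0 + (1 - c) * P.rates d 1 = c * (1 - ∫ x, P.score x ∂P.μ) +
      ∫ x, Decision.accept d x * (P.score x - c) ∂P.μ := by
  have : (fun x => Decision.accept d x * (P.score x - c)) =
      fun x => Decision.accept d x * P.score x - c * Decision.accept d x := by
    funext x; ring
  rw [this, integral_sub (integrable_accept_mul_score d) ((integrable_accept d).const_mul c),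
    integral_const_mul, rates_zero', ← rates_one]
  ring

lemma integrable_accept_mul_sub (d : P.Decision) (c : ℝ) :
    Integrable (fun x => Decision.accept d x * (P.score x - c)) P.μ := by
  have : (fun x => Decision.accept d x * (P.score x - c)) =
      fun x => Decision.accept d x * P.score x - c * Decision.accept d x := by
    funext x; ring
  rw [this]
  exact (integrable_accept_mul_score d).sub ((integrable_accept d).const_mul c)

lemma accept_mul_le_threshold (d : P.Decision) (c : ℝ) (x : P.carrier) :
    Decision.accept d x * (P.score x - c) ≤
      Decision.accept (P.threshold c) x * (P.score x - c) := by
  have hd := accept_mem d x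
  rw [accept_threshold]
  by_cases h : c < P.score x
  · simp only [indicator, mem_ofPred_eq, h, if_true, Pi.one_apply]
    exact mul_le_mul_of_nonneg_right hd.2 (by linarith)
  · simp only [indicator, mem_ofPred_eq, h, if_false, zero_mul]
    exact mul_nonpos_of_nonneg_of_nonpos hd.1 (by linarith)

lemma weighted_rates_le_threshold (d : P.Decision) (c : ℝ) :
    c * P.rates d 0 + (1 - c) * P.rates d 1 ≤
      c * P.rates (P.threshold c) 0 + (1 - c) * P.rates (P.threshold c) 1 := by
  rw [weighted_rates, weighted_rates]
  exact add_le_add_right (integral_mono (integrable_accept_mul_sub _ _)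
    (integrable_accept_mul_sub _ _) (accept_mul_le_threshold d c)) _

/-- A threshold decision is the unique maximiser of a weighted sum of the rates. -/
lemma ae_eq_threshold_of_le {d : P.Decision} {c : ℝ}
    (h : c * P.rates (P.threshold c) 0 + (1 - c) * P.rates (P.threshold c) 1 ≤
      c * P.rates d 0 + (1 - c) * P.rates d 1) :
    Decision.accept d =ᵐ[P.μ] Decision.accept (P.threshold c) := by
  rw [weighted_rates, weighted_rates] at h
  have hle := fun x => accept_mul_le_threshold d c x
  have heq := (integral_eq_iff_of_ae_le (integrable_accept_mul_sub d c)
    (integrable_accept_mul_sub (P.threshold c) c) (Filter.Eventually.of_forall hle)).1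
    (le_antisymm (integral_mono (integrable_accept_mul_sub _ _) (integrable_accept_mul_sub _ _)
      hle) (by linarith))
  filter_upwards [heq, ae_score_ne c] with x hx hc
  exact mul_right_cancel₀ (sub_ne_zero.2 hc) hx

lemma rates_congr_ae {d d' : P.Decision}
    (h : Decision.accept d =ᵐ[P.μ] Decision.accept d') : P.rates d = P.rates d' := by
  have h1 : P.rates d 1 = P.rates d' 1 := by
    rw [rates_one, rates_one]
    apply integral_congr_ae
    filter_upwards [h] with x hx
    rw [hx]
  funext i
  fin_cases i
  · change P.rates d 0 = P.rates d' 0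
    rw [rates_zero', rates_zero', h1, integral_congr_ae h]
  · exact h1

lemma rates_ext {d d' : P.Decision}
    (h : ∫ x, Decision.accept d x ∂P.μ = ∫ x, Decision.accept d' x ∂P.μ)
    (h' : ∫ x, Decision.accept d x * P.score x ∂P.μ =
      ∫ x, Decision.accept d' x * P.score x ∂P.μ) : P.rates d = P.rates d' := by
  have h1 : P.rates d 1 = P.rates d' 1 := by rw [rates_one, rates_one, h']
  funext i
  fin_cases i
  · change P.rates d 0 = P.rates d' 0
    rw [rates_zero', rates_zero', h1, h]
  · exact h1

/-! ### The IPS determines the law of the score, so `ℓ̂` and `𝓕̂` are well defined. -/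

/-- By conditioning on the score, every decision can be replaced by one that depends on the
score only and has the same rates. -/
lemma exists_pullback_rates_eq (d : P.Decision) :
    ∃ e : P.onSimplex.Decision, P.rates (P.pullback e) = P.rates d := by
  set m : MeasurableSpace P.carrier := MeasurableSpace.comap P.p inferInstance with hm_def
  have hm : m ≤ P.mspace := P.measurable_p.comap_le
  obtain ⟨h, hh, hcomp⟩ := (stronglyMeasurable_condExp (μ := P.μ) (m := m)
    (f := Decision.accept d)).measurable.exists_eq_measurable_comp
  let e : P.onSimplex.Decision :=
    ⟨fun z => simplexOfReal (h z.down), measurable_simplexOfReal.comp (hh.comp measurable_down)⟩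
  have hnonneg : 0 ≤ᵐ[P.μ] P.μ[Decision.accept d | m] :=
    condExp_nonneg (Filter.Eventually.of_forall fun x => (accept_mem d x).1)
  have hle : P.μ[Decision.accept d | m] ≤ᵐ[P.μ] fun _ => 1 := by
    have := condExp_mono (m := m) (integrable_accept d) (integrable_const (1 : ℝ))
      (Filter.Eventually.of_forall fun x => (accept_mem d x).2)
    rwa [condExp_const hm] at this
  have hacc : Decision.accept (P.pullback e) =ᵐ[P.μ] P.μ[Decision.accept d | m] := by
    filter_upwards [hnonneg, hle] with x h0 h1
    have hx := congrFun hcomp x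
    have := simplexOfReal_one (r := h (P.p x)) (by
      rw [hx] at h0 h1
      exact ⟨h0, h1⟩)
    rw [hx]
    exact this
  have hscore : StronglyMeasurable[m] P.score := by
    apply Measurable.stronglyMeasurable
    exact (measurable_simplex_apply 1).comp (comap_measurable P.p)
  refine ⟨e, rates_ext ?_ ?_⟩
  · rw [integral_congr_ae hacc, integral_condExp hm]
  -- The score is measurable with respect to `p`, so it can be pulled out of the conditional
  -- expectation.
  · have hmul := condExp_mul_of_stronglyMeasurable_right (μ := P.μ) (m := m) hscore
      (f := Decision.accept d) (integrable_accept_mul_score d) (integrable_accept d)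
    rw [← integral_condExp (μ := P.μ) (f := fun x => Decision.accept d x * P.score x) hm]
    apply integral_congr_ae
    have hmul' : P.μ[fun x => Decision.accept d x * P.score x | m] =ᵐ[P.μ]
      P.μ[Decision.accept d | m] * P.score := hmul
    filter_upwards [hacc, hmul'] with x hx hx'
    rw [hx, hx', Pi.mul_apply]

lemma confusion_onSimplex (e : P.onSimplex.Decision) :
    P.onSimplex.confusion e = P.confusion (P.pullback e) := by
  ext i j
  have hm : Measurable fun x => (ULift.up (P.p x) : ULift.{u} Simplex) :=
    measurable_up.comp P.measurable_p
  exact integral_map (μ := P.μ) hm.aemeasurable (f := fun z : ULift.{u} Simplex =>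
    (e.1 z : Fin 2 → ℝ) j * (z.down : Fin 2 → ℝ) i)
    (((measurable_simplex_apply j).comp e.2).mul
      ((measurable_simplex_apply i).comp measurable_down)).aestronglyMeasurable

/-- The rates of the threshold at `c` are the unique point of the IPS that maximises `c tnr + (1 -
c) tpr`, a description in terms of the set alone. -/
lemma rates_threshold_eq_of_IPS_eq {Q : Problem.{u}} (h : P.IPS = Q.IPS) (c : ℝ) :
    P.rates (P.threshold c) = Q.rates (Q.threshold c) := by
  have h1 : P.rates (P.threshold c) ∈ Q.IPS := h ▸ mem_range_self _
  have h2 : Q.rates (Q.threshold c) ∈ P.IPS := h ▸ mem_range_self _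
  obtain ⟨d, hd⟩ := h1
  obtain ⟨e, he⟩ := h2
  rw [← hd]
  apply rates_congr_ae
  apply ae_eq_threshold_of_le
  rw [hd, ← he]
  exact weighted_rates_le_threshold e c

lemma integral_accept_threshold (c : ℝ) :
    ∫ x, Decision.accept (P.threshold c) x ∂P.μ = P.μ.real {x | c < P.score x} := by
  rw [integral_congr_ae (Filter.Eventually.of_forall (accept_threshold c))]
  exact integral_indicator_one (measurable_score measurableSet_Ioi)

lemma measure_score_gt_eq_of_IPS_eq {Q : Problem.{u}} (h : P.IPS = Q.IPS) (c : ℝ) :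
    P.μ {x | c < P.score x} = Q.μ {x | c < Q.score x} := by
  -- No score exceeds 2, so the threshold at 2 rejects everyone and its true negative rate is `1 - ∫
  -- s`. By `rates_zero'` the right side is then the acceptance probability of the threshold at `c`.
  have aux : ∀ R : Problem.{u}, R.μ.real {x | c < R.score x} =
      R.rates (R.threshold 2) 0 - R.rates (R.threshold c) 0 + R.rates (R.threshold c) 1 := by
    intro R
    have hne : {x : R.carrier | 2 < R.score x} = ∅ := by
      ext x
      simp only [mem_ofPred_eq, mem_empty_iff_false, iff_false, not_lt]
      linarith [(score_mem (P := R) x).2]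
    have h0 : Decision.accept (R.threshold 2) = 0 := by
      funext x
      rw [accept_threshold, hne]
      simp
    have h1 : R.rates (R.threshold 2) 1 = 0 := by
      rw [rates_one, h0]
      simp
    rw [rates_zero' (R.threshold 2), rates_zero' (R.threshold c), h1, h0,
      integral_accept_threshold]
    simp only [Pi.zero_apply, integral_zero]
    ring
  have := aux P
  rw [rates_threshold_eq_of_IPS_eq h, rates_threshold_eq_of_IPS_eq h, ← aux Q] at this
  exact (measureReal_eq_measureReal_iff).1 this

lemma map_p_eq_of_IPS_eq {Q : Problem.{u}} (h : P.IPS = Q.IPS) : P.μ.map P.p = Q.μ.map Q.p := by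
  have hlaw : P.μ.map P.score = Q.μ.map Q.score := by
    have := Measure.isProbabilityMeasure_map (μ := P.μ) (measurable_score (P := P)).aemeasurable
    have := Measure.isProbabilityMeasure_map (μ := Q.μ) (measurable_score (P := Q)).aemeasurable
    apply Measure.ext_of_Iic
    intro c
    rw [← compl_Ioi, prob_compl_eq_one_sub measurableSet_Ioi,
      prob_compl_eq_one_sub measurableSet_Ioi, Measure.map_apply measurable_score measurableSet_Ioi,
      Measure.map_apply measurable_score measurableSet_Ioi]
    exact congrArg (1 - ·) (measure_score_gt_eq_of_IPS_eq h c)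
  have aux : ∀ R : Problem.{u}, R.μ.map R.p = (R.μ.map R.score).map simplexOfReal := by
    intro R
    rw [Measure.map_map measurable_simplexOfReal measurable_score]
    congr 1
    funext x
    exact simplex_ext (simplexOfReal_one (score_mem x)).symm
  rw [aux P, aux Q, hlaw]

/-- The individual pieces set determines the law of the conditional label distribution. -/
lemma onSimplex_eq_of_IPS_eq {Q : Problem.{u}} (h : P.IPS = Q.IPS) :
    P.onSimplex = Q.onSimplex := by
  have hμ : P.μ.map (fun x => (ULift.up (P.p x) : ULift.{u} Simplex)) =
      Q.μ.map fun x => ULift.up (Q.p x) := by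
    have aux : ∀ R : Problem.{u}, R.μ.map (fun x => (ULift.up (R.p x) : ULift.{u} Simplex)) =
        (R.μ.map R.p).map ULift.up := by
      intro R
      rw [Measure.map_map measurable_up R.measurable_p]
      rfl
    rw [aux P, aux Q, map_p_eq_of_IPS_eq h]
  unfold onSimplex
  congr 1

end Problem

lemma EvaluationMetric.eval_congr (l : EvaluationMetric.{u}) {P : Problem.{u}}
    {d d' : P.Decision} (h : P.rates d = P.rates d') : l.eval P d = l.eval P d' :=
  le_antisymm (l.mono _ _ _ (Problem.paretoLE_iff.2 h.le))
    (l.mono _ _ _ (Problem.paretoLE_iff.2 h.ge))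

lemma EvaluationMetric.eval_eq_of_eq (l : EvaluationMetric.{u}) {P Q : Problem.{u}} (h : P = Q)
    {d : P.Decision} {e : Q.Decision} (hr : P.rates d = Q.rates e) :
    l.eval P d = l.eval Q e := by
  subst h
  exact l.eval_congr hr

/-- Both decisions can be moved to the simplex without changing rates or values, and there the two
problems are literally equal. -/
lemma EvaluationMetric.eval_eq_of_IPS_eq (l : EvaluationMetric.{u}) {P Q : Problem.{u}}
    (h : P.IPS = Q.IPS) {d : P.Decision} {e : Q.Decision} (hr : P.rates d = Q.rates e) :
    l.eval P d = l.eval Q e := by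
  obtain ⟨d', hd'⟩ := Problem.exists_pullback_rates_eq d
  obtain ⟨e', he'⟩ := Problem.exists_pullback_rates_eq e
  rw [← l.eval_congr hd', ← l.eval_congr he', l.invariant, l.invariant]
  apply l.eval_eq_of_eq (Problem.onSimplex_eq_of_IPS_eq h)
  have h1 : P.onSimplex.rates d' = P.rates (P.pullback d') :=
    congrArg Matrix.diag (Problem.confusion_onSimplex d')
  have h2 : Q.onSimplex.rates e' = Q.rates (Q.pullback e') :=
    congrArg Matrix.diag (Problem.confusion_onSimplex e')
  rw [h1, h2, hd', he', hr]

/-- All witnesses in the choice defining `hat` give the same value, so the chosen one is harmless.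
-/
lemma EvaluationMetric.hat_rates (l : EvaluationMetric.{u}) {P : Problem.{u}} (d : P.Decision) :
    l.hat (P.rates d) P.IPS = l.eval P d := by
  obtain ⟨Q, e, hr, hE, hv⟩ := Classical.epsilon_spec (p := fun v : ℝ =>
    ∃ (Q : Problem.{u}) (e : Q.Decision), Q.rates e = P.rates d ∧ Q.IPS = P.IPS ∧
      l.eval Q e = v) ⟨_, P, d, rfl, rfl, rfl⟩
  exact hv.symm.trans (l.eval_eq_of_IPS_eq hE hr)

namespace FairnessMeasure

variable (f : FairnessMeasure.{u})

lemma val_congr {P Q : Problem.{u}} {d d' : P.Decision} {e e' : Q.Decision}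
    (hd : P.rates d = P.rates d') (he : Q.rates e = Q.rates e') :
    f.val P Q d e = f.val P Q d' e' :=
  f.congr_confusion _ _ _ _ _ _ (Problem.confusion_eq_of_rates_eq hd)
    (Problem.confusion_eq_of_rates_eq he)

lemma val_eq_of_eq {P P' Q Q' : Problem.{u}} (hP : P = P') (hQ : Q = Q')
    {d : P.Decision} {d' : P'.Decision} {e : Q.Decision} {e' : Q'.Decision}
    (hd : P.rates d = P'.rates d') (he : Q.rates e = Q'.rates e') :
    f.val P Q d e = f.val P' Q' d' e' := by
  subst hP hQ
  exact f.val_congr hd he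

lemma val_eq_of_IPS_eq {P P' Q Q' : Problem.{u}} (hP : P.IPS = P'.IPS) (hQ : Q.IPS = Q'.IPS)
    {d : P.Decision} {d' : P'.Decision} {e : Q.Decision} {e' : Q'.Decision}
    (hd : P.rates d = P'.rates d') (he : Q.rates e = Q'.rates e') :
    f.val P Q d e = f.val P' Q' d' e' := by
  obtain ⟨a, ha⟩ := Problem.exists_pullback_rates_eq d
  obtain ⟨a', ha'⟩ := Problem.exists_pullback_rates_eq d'
  obtain ⟨b, hb⟩ := Problem.exists_pullback_rates_eq e
  obtain ⟨b', hb'⟩ := Problem.exists_pullback_rates_eq e'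
  rw [← f.val_congr ha hb, ← f.val_congr ha' hb', f.invariant, f.invariant]
  have key : ∀ {R : Problem.{u}} (c : R.onSimplex.Decision),
      R.onSimplex.rates c = R.rates (R.pullback c) := fun c =>
    congrArg Matrix.diag (Problem.confusion_onSimplex c)
  apply f.val_eq_of_eq (Problem.onSimplex_eq_of_IPS_eq hP) (Problem.onSimplex_eq_of_IPS_eq hQ)
  · rw [key, key, ha, ha', hd]
  · rw [key, key, hb, hb', he]

lemma hat_rates {P Q : Problem.{u}} (d : P.Decision) (e : Q.Decision) :
    f.hat (P.rates d) P.IPS (Q.rates e) Q.IPS = f.val P Q d e := by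
  obtain ⟨P', Q', d', e', hd, hP, he, hQ, hv⟩ := Classical.epsilon_spec (p := fun v : ℝ =>
    ∃ (P' Q' : Problem.{u}) (d' : P'.Decision) (e' : Q'.Decision), P'.rates d' = P.rates d ∧
      P'.IPS = P.IPS ∧ Q'.rates e' = Q.rates e ∧ Q'.IPS = Q.IPS ∧ f.val P' Q' d' e' = v)
    ⟨_, P, Q, d, e, rfl, rfl, rfl, rfl, rfl⟩
  exact hv.symm.trans (f.val_eq_of_IPS_eq hP hQ hd he)

end FairnessMeasure

/-! ### Compactness of the IPS. -/

namespace Problem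

variable {P : Problem.{u}}

/-- The individual pieces set is compact, because decisions form a weakly compact subset
of `L²`. -/
lemma isCompact_IPS : IsCompact P.IPS := by
  have memLp_of_mem : ∀ {g : P.carrier → ℝ}, Measurable g → (∀ x, g x ∈ Icc (0 : ℝ) 1) →
      MemLp g 2 P.μ := fun hg h =>
    MemLp.of_bound hg.aestronglyMeasurable 1
      (Filter.Eventually.of_forall fun x => abs_le_one_of_mem (h x))
  set one : Lp ℝ 2 P.μ := (memLp_const (1 : ℝ)).toLp _ with hone
  set sc : Lp ℝ 2 P.μ := (memLp_of_mem measurable_score score_mem).toLp _ with hsc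
  have inner_eq : ∀ {g h : P.carrier → ℝ} (hg : MemLp g 2 P.μ) (k : Lp ℝ 2 P.μ), k =ᵐ[P.μ] h →
      inner ℝ (hg.toLp g) k = ∫ x, g x * h x ∂P.μ := by
    intro g h hg k hk
    rw [L2.inner_def]
    apply integral_congr_ae
    filter_upwards [hg.coeFn_toLp, hk] with x hx hx'
    rw [hx, hx']
    exact mul_comm _ _
  -- `K` consists of the functionals between 0 and integration on the positive cone. Under the Riesz
  -- isomorphism these are the functions with values in `[0,1]` almost everywhere. Banach–Alaoglu
  -- applies to `K`.
  let K : Set (WeakDual ℝ (Lp ℝ 2 P.μ)) :=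
    {φ | ∀ g : Lp ℝ 2 P.μ, 0 ≤ g → 0 ≤ φ g ∧ φ g ≤ inner ℝ one g}
  have hK : IsCompact K := by
    apply WeakDual.isCompact_of_bounded_of_closed
    · refine (Metric.isBounded_iff_subset_closedBall 0).2 ⟨‖one‖, fun φ hφ => ?_⟩
      rw [mem_closedBall_zero_iff]
      refine ContinuousLinearMap.opNorm_le_bound _ (norm_nonneg _) fun g => ?_
      have hφ' : ∀ g : Lp ℝ 2 P.μ, 0 ≤ g → 0 ≤ φ g ∧ φ g ≤ inner ℝ one g := hφ
      -- Positivity on `|g| - g` and `|g| + g` gives `|φ g| ≤ φ |g|`.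
      have h1 := (hφ' (|g| - g) (sub_nonneg.2 (le_abs_self g))).1
      have h2 := (hφ' (|g| + g) (neg_le_iff_add_nonneg.1 (neg_le_abs g))).1
      have h3 := (hφ' |g| (abs_nonneg g)).2
      rw [map_sub] at h1
      rw [map_add] at h2
      have h4 : inner ℝ one |g| ≤ ‖one‖ * ‖g‖ := by
        rw [← norm_abs_eq_norm g]
        exact real_inner_le_norm _ _
      rw [Real.norm_eq_abs, abs_le]
      constructor <;> linarith
    · simp only [K, ofPred_forall]
      refine isClosed_iInter fun g => isClosed_iInter fun _ => ?_
      have hc : Continuous fun φ : WeakDual ℝ (Lp ℝ 2 P.μ) => φ g := WeakDual.eval_continuous g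
      exact (isClosed_le continuous_const hc).inter (isClosed_le hc continuous_const)
  -- The rates written through `∫ a` and `∫ a s`, as in `rates_zero'`; both are evaluations of a
  -- functional and hence weak-* continuous.
  let T : WeakDual ℝ (Lp ℝ 2 P.μ) → Fin 2 → ℝ :=
    fun φ => ![(1 - ∫ x, P.score x ∂P.μ) - φ one + φ sc, φ sc]
  have hT : Continuous T := by
    have h1 : Continuous fun φ : WeakDual ℝ (Lp ℝ 2 P.μ) => φ one := WeakDual.eval_continuous one
    have h2 : Continuous fun φ : WeakDual ℝ (Lp ℝ 2 P.μ) => φ sc := WeakDual.eval_continuous sc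
    refine continuous_pi fun i => ?_
    fin_cases i
    · exact (continuous_const.sub h1).add h2
    · exact h2
  have hrates : ∀ (d : P.Decision) (φ : WeakDual ℝ (Lp ℝ 2 P.μ)),
      (φ one = ∫ x, Decision.accept d x ∂P.μ) →
      (φ sc = ∫ x, Decision.accept d x * P.score x ∂P.μ) → T φ = P.rates d := by
    intro d φ h1 h2
    funext i
    fin_cases i
    · change (1 - ∫ x, P.score x ∂P.μ) - φ one + φ sc = P.rates d 0
      rw [rates_zero', rates_one, h1, h2]
    · exact h2
  suffices h : P.IPS = T '' K by
    rw [h]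
    exact hK.image hT
  apply Subset.antisymm
  · rintro _ ⟨d, rfl⟩
    have hd := memLp_of_mem (measurable_accept d) (accept_mem d)
    let φ : WeakDual ℝ (Lp ℝ 2 P.μ) := StrongDual.toWeakDual (innerSL ℝ (hd.toLp _))
    have hφ : ∀ g, φ g = inner ℝ (hd.toLp _) g := fun g => rfl
    refine ⟨φ, fun g hg => ?_, hrates d φ ?_ ?_⟩
    · have hg' : ∀ᵐ x ∂P.μ, 0 ≤ g x := by
        filter_upwards [(Lp.coeFn_nonneg g).2 hg] with x hx using hx
      have hgi : Integrable g P.μ := (Lp.memLp g).integrable (by norm_num)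
      rw [hφ, inner_eq hd g (Filter.EventuallyEq.rfl), hone,
        inner_eq (memLp_const 1) g (Filter.EventuallyEq.rfl)]
      constructor
      · apply integral_nonneg_of_ae
        filter_upwards [hg'] with x hx using mul_nonneg (accept_mem d x).1 hx
      · apply integral_mono_ae
        · exact hgi.bdd_mul (c := 1) (measurable_accept d).aestronglyMeasurable
            (Filter.Eventually.of_forall fun x => abs_le_one_of_mem (accept_mem d x))
        · simpa using hgi
        · filter_upwards [hg'] with x hx
          exact mul_le_mul_of_nonneg_right (accept_mem d x).2 hx
    · rw [hφ, inner_eq hd one (h := fun _ => 1) (MemLp.coeFn_toLp _)]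
      simp
    · rw [hφ, inner_eq hd sc (MemLp.coeFn_toLp _)]
  · rintro _ ⟨φ, hφ, rfl⟩
    have hφ' : ∀ g : Lp ℝ 2 P.μ, 0 ≤ g → 0 ≤ φ g ∧ φ g ≤ inner ℝ one g := hφ
    let w : Lp ℝ 2 P.μ := (InnerProductSpace.toDual ℝ (Lp ℝ 2 P.μ)).symm
      (WeakDual.toStrongDual φ)
    have hw : ∀ g, φ g = inner ℝ w g := fun g =>
      (InnerProductSpace.toDual_symm_apply (𝕜 := ℝ) (x := g)
        (y := WeakDual.toStrongDual φ)).symm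
    have hwi : Integrable w P.μ := (Lp.memLp w).integrable (by norm_num)
    -- Testing on indicators bounds the Riesz representative between 0 and 1 almost everywhere.
    have hset : ∀ s, MeasurableSet s → 0 ≤ ∫ x in s, w x ∂P.μ ∧
        ∫ x in s, w x ∂P.μ ≤ ∫ x in s, (1 : ℝ) ∂P.μ := by
      intro s hs
      have h0 : (0 : Lp ℝ 2 P.μ) ≤ indicatorConstLp 2 hs (measure_ne_top P.μ s) (1 : ℝ) := by
        rw [← Lp.coeFn_nonneg]
        filter_upwards [indicatorConstLp_coeFn (p := 2) (hs := hs)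
          (hμs := measure_ne_top P.μ s) (c := (1 : ℝ))] with x hx
        rw [hx]
        exact indicator_nonneg (fun _ _ => zero_le_one) x
      have := hφ' _ h0
      rw [hw, real_inner_comm, real_inner_comm _ one, L2.inner_indicatorConstLp_one,
        L2.inner_indicatorConstLp_one] at this
      refine ⟨this.1, this.2.trans_eq ?_⟩
      apply setIntegral_congr_ae hs
      filter_upwards [(memLp_const (1 : ℝ)).coeFn_toLp (μ := P.μ) (p := 2)] with x hx _
      exact hx
    have hw0 : 0 ≤ᵐ[P.μ] w :=
      ae_nonneg_of_forall_setIntegral_nonneg hwi fun s hs _ => (hset s hs).1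
    have hw1 : w ≤ᵐ[P.μ] fun _ => (1 : ℝ) :=
      ae_le_of_forall_setIntegral_le hwi (integrable_const _) fun s hs _ => (hset s hs).2
    let d := P.decisionOf w (Lp.stronglyMeasurable w).measurable
    have hd : Decision.accept d =ᵐ[P.μ] w := by
      filter_upwards [hw0, hw1] with x h0 h1
      exact accept_decisionOf _ ⟨h0, h1⟩
    have hd2 := memLp_of_mem (measurable_accept d) (accept_mem d)
    have hwd : w = hd2.toLp _ := Lp.ext (hd.symm.trans (hd2.coeFn_toLp).symm)
    refine ⟨d, (hrates d φ ?_ ?_).symm⟩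
    · rw [hw, hwd, inner_eq hd2 one (h := fun _ => 1) (MemLp.coeFn_toLp _)]
      simp
    · rw [hw, hwd, inner_eq hd2 sc (MemLp.coeFn_toLp _)]

end Problem

end

end CherryPick

/-! ### Climbing a box without increasing a function. -/

namespace CherryPick

open Filter Topology in
lemma exists_gt_lt_of_hasDerivAt_neg {g : ℝ → ℝ} {a b g' : ℝ} (hg : HasDerivAt g g' a)
    (hneg : g' < 0) (hab : a < b) : ∃ r, a < r ∧ r < b ∧ g r < g a := by
  have h1 : ∀ᶠ r in 𝓝[>] a, slope g a r < 0 :=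
    ((hasDerivAt_iff_tendsto_slope.1 hg).mono_left
      (nhdsWithin_mono a fun r (hr : a < r) => hr.ne')).eventually (gt_mem_nhds hneg)
  have h2 : ∀ᶠ r in 𝓝[>] a, r ∈ Ioo a b := Ioo_mem_nhdsGT hab
  obtain ⟨r, hr, hr'⟩ := (h1.and h2).exists
  refine ⟨r, hr'.1, hr'.2, ?_⟩
  rw [slope_def_field, div_neg_iff] at hr
  rcases hr with ⟨_, h⟩ | ⟨h, _⟩
  · linarith [hr'.1]
  · linarith

/-- The points of a box whose coordinates are not all below those of the upper corner. -/
lemma isCompact_upperFaces (t u : Fin 2 → ℝ) : IsCompact {v ∈ Icc t u | ∃ i, v i = u i} := by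
  have : {v ∈ Icc t u | ∃ i, v i = u i} = Icc t u ∩ ⋃ i, {v | v i = u i} := by
    ext v
    simp
  rw [this]
  exact isCompact_Icc.inter_right
    (isClosed_iUnion_of_finite fun i => isClosed_eq (continuous_apply i) continuous_const)

/-- If at each point of a box one of the partial derivatives is nonpositive, then the function
is on some upper face at most its value at the lower corner. -/
lemma exists_upperFace_le {φ : (Fin 2 → ℝ) → ℝ} {t u : Fin 2 → ℝ} (htu : ∀ i, t i < u i)
    (hc : ContinuousOn φ (Icc t u))
    (hd : ∀ v ∈ Icc t u, ∃ i, ∃ φ' ≤ 0,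
      HasDerivAt (fun r => φ (Function.update v i r)) φ' (v i)) :
    ∃ v ∈ Icc t u, (∃ i, v i = u i) ∧ φ v ≤ φ t := by
  have hle : t ≤ u := fun i => (htu i).le
  obtain ⟨b, hb, hbmin⟩ := (isCompact_upperFaces t u).exists_isMinOn
    ⟨u, right_mem_Icc.2 hle, 0, rfl⟩ (hc.mono fun v hv => hv.1)
  by_contra! hcon
  have hlt := hcon b hb.1 hb.2
  set D : ℝ := ∑ i, (u i - t i) with hD
  have hDpos : 0 < D := Finset.sum_pos (fun i _ => sub_pos.2 (htu i)) Finset.univ_nonempty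
  -- A slope so small that the tilt `ε ∑ (v i - t i)` over the whole box is at most half of the gap
  -- to the minimum `φ b` on the upper faces.
  set ε : ℝ := (φ b - φ t) / (2 * D) with hε
  have hεpos : 0 < ε := div_pos (sub_pos.2 hlt) (by linarith)
  have hεD : ε * D = (φ b - φ t) / 2 := by
    rw [hε]; field_simp
  set S : Set (Fin 2 → ℝ) := {v ∈ Icc t u | φ v - ε * ∑ i, (v i - t i) ≤ φ t} with hS
  have hcont : ContinuousOn (fun v => φ v - ε * ∑ i, (v i - t i)) (Icc t u) :=
    hc.sub (by fun_prop)
  have hScomp : IsCompact S := by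
    have : S = Icc t u ∩ (fun v => φ v - ε * ∑ i, (v i - t i)) ⁻¹' Iic (φ t) := rfl
    rw [this]
    exact isCompact_Icc.of_isClosed_subset
      (hcont.preimage_isClosed_of_isClosed isClosed_Icc isClosed_Iic) inter_subset_left
  have hsum : Continuous fun v : Fin 2 → ℝ => ∑ i, v i := by fun_prop
  -- Take a highest point of the tilted sublevel set. On an upper face its value would be below `φ
  -- b`; elsewhere the tilt makes a derivative strictly negative, so one coordinate can still be
  -- raised within the set.
  obtain ⟨v, hv, hvmax⟩ := hScomp.exists_isMaxOn ⟨t, left_mem_Icc.2 hle, by simp⟩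
    hsum.continuousOn
  have hvD : ∑ i, (v i - t i) ≤ D :=
    Finset.sum_le_sum fun i _ => sub_le_sub_right (hv.1.2 i) _
  by_cases hface : ∃ i, v i = u i
  · have h1 : φ b ≤ φ v := hbmin ⟨hv.1, hface⟩
    have h2 := hv.2
    have h3 := mul_le_mul_of_nonneg_left hvD hεpos.le
    linarith
  · push Not at hface
    obtain ⟨i, φ', hφ', hder⟩ := hd v hv.1
    have hder' : HasDerivAt (fun r => φ (Function.update v i r) - ε * r) (φ' - ε) (v i) := by
      have := hder.sub ((hasDerivAt_id (v i)).const_mul ε)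
      rw [mul_one] at this
      exact this
    obtain ⟨r, hr, hru, hrlt⟩ := exists_gt_lt_of_hasDerivAt_neg hder' (by linarith)
      (lt_of_le_of_ne (hv.1.2 i) (hface i))
    simp only [Function.update_eq_self] at hrlt
    have hup : ∑ j, Function.update v i r j = ∑ j, v j + (r - v i) := by
      rw [Finset.sum_update_of_mem (Finset.mem_univ i),
        ← Finset.add_sum_erase _ _ (Finset.mem_univ i), Finset.sdiff_singleton_eq_erase]
      ring
    have hmem : Function.update v i r ∈ S := by
      refine ⟨⟨?_, ?_⟩, ?_⟩
      · rw [le_update_iff]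
        exact ⟨(hv.1.1 i).trans hr.le, fun j _ => hv.1.1 j⟩
      · rw [update_le_iff]
        exact ⟨hru.le, fun j _ => hv.1.2 j⟩
      · have := hv.2
        simp only [Finset.sum_sub_distrib] at this ⊢
        rw [hup]
        linarith
    have hmax : ∑ j, Function.update v i r j ≤ ∑ j, v j := hvmax hmem
    linarith

lemma box_subset_interior {E : Set (Fin 2 → ℝ)} (hE : E.OrdConnected) {t u v : Fin 2 → ℝ}
    (ht : t ∈ E) (hu : u ∈ E) (hv : ∀ i, t i < v i ∧ v i < u i) : v ∈ interior E := by
  refine interior_maximal (s := E) (t := Set.pi univ fun i => Ioo (t i) (u i)) ?_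
    (isOpen_set_pi finite_univ fun i _ => isOpen_Ioo) fun i _ => hv i
  exact fun w hw => hE.out ht hu ⟨fun i => (hw i trivial).1.le, fun i => (hw i trivial).2.le⟩

open Filter Topology in
/-- A point below an interior point of `E` can be moved up without increasing `Φ`. -/
lemma exists_gt_le_of_min_deriv_nonpos {E E' : Set (Fin 2 → ℝ)}
    {Φ : (Fin 2 → ℝ) × (Fin 2 → ℝ) → ℝ} (hΦ : ContDiffOn ℝ 1 Φ (E ×ˢ E'))
    (hE : E.OrdConnected) (hE' : Convex ℝ E') (hint : (interior E').Nonempty)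
    (hmin : ∀ t ∈ interior E, ∀ s ∈ interior E',
      min (deriv (fun r => Φ (Function.update t 0 r, s)) (t 0))
        (deriv (fun r => Φ (Function.update t 1 r, s)) (t 1)) ≤ 0)
    {t u s : Fin 2 → ℝ} (ht : t ∈ E) (hu : u ∈ E) (htu : ∀ i, t i < u i) (hs : s ∈ E') :
    ∃ v ∈ E, t ≤ v ∧ (∃ i, t i < v i) ∧ Φ (v, s) ≤ Φ (t, s) := by
  -- With the midpoint as upper corner, the closed boxes below stay in the interior of `E`, while
  -- the target faces do not depend on `n`.
  set w : Fin 2 → ℝ := fun i => (t i + u i) / 2 with hw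
  have htw : ∀ i, t i < w i := fun i => by simp only [hw]; linarith [htu i]
  have hwu : ∀ i, w i < u i := fun i => by simp only [hw]; linarith [htu i]
  obtain ⟨s', hs', hs'lim⟩ := mem_closure_iff_seq_limit.1
    (show s ∈ closure (interior E') by
      rw [hE'.closure_interior_eq_closure_of_nonempty_interior hint]
      exact subset_closure hs)
  -- The final factor `1/2` keeps `δ 0 < 1`, so every lower corner `t' n` is strictly below `w`.
  set δ : ℕ → ℝ := fun n => 1 / ((n : ℝ) + 1) / 2 with hδ
  have hδpos : ∀ n, 0 < δ n := fun n => by positivity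
  have hδlt : ∀ n, δ n < 1 := fun n => by
    have : 1 / ((n : ℝ) + 1) ≤ 1 := by
      rw [div_le_one (by positivity)]
      linarith [n.cast_nonneg (α := ℝ)]
    simp only [hδ]
    linarith
  have hδlim : Tendsto δ atTop (𝓝 0) := by
    have := (tendsto_one_div_add_atTop_nhds_zero_nat (𝕜 := ℝ)).div_const 2
    rw [zero_div] at this
    exact this
  set t' : ℕ → Fin 2 → ℝ := fun n i => t i + δ n * (w i - t i) with ht'
  have ht'lim : Tendsto t' atTop (𝓝 t) := by
    rw [tendsto_pi_nhds]
    intro i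
    simpa using (hδlim.mul_const (w i - t i)).const_add (t i)
  have htt' : ∀ n i, t i < t' n i := fun n i => by
    have := mul_pos (hδpos n) (sub_pos.2 (htw i))
    simp only [ht']
    linarith
  have ht'w : ∀ n i, t' n i < w i := fun n i => by
    have := mul_lt_mul_of_pos_right (hδlt n) (sub_pos.2 (htw i))
    simp only [ht']
    linarith
  have hbox : ∀ n, ∀ v ∈ Icc (t' n) w, v ∈ interior E := fun n v hv =>
    box_subset_interior hE ht hu fun i =>
      ⟨(htt' n i).trans_le (hv.1 i), (hv.2 i).trans_lt (hwu i)⟩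
  have hdiff : ∀ v ∈ interior E, ∀ y ∈ interior E', DifferentiableAt ℝ Φ (v, y) := by
    intro v hv y hy
    refine (hΦ.contDiffAt ?_).differentiableAt (by norm_num)
    exact prod_mem_nhds (mem_interior_iff_mem_nhds.1 hv) (mem_interior_iff_mem_nhds.1 hy)
  have hstep : ∀ n, ∃ v ∈ Icc (t' n) w, (∃ i, v i = w i) ∧ Φ (v, s' n) ≤ Φ (t' n, s' n) := by
    intro n
    refine exists_upperFace_le (φ := fun v => Φ (v, s' n)) (ht'w n) ?_ fun v hv => ?_
    · refine hΦ.continuousOn.comp (by fun_prop) fun v hv => ?_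
      exact ⟨interior_subset (hbox n v hv), interior_subset (hs' n)⟩
    · have hpd : ∀ i, DifferentiableAt ℝ (fun r => Φ (Function.update v i r, s' n)) (v i) := by
        intro i
        have h1 := hdiff v (hbox n v hv) (s' n) (hs' n)
        have h2 : HasDerivAt (fun r => Function.update v i r) _ (v i) := hasDerivAt_update v i (v i)
        have h3 : DifferentiableAt ℝ (fun r => (Function.update v i r, s' n)) (v i) :=
          h2.differentiableAt.prodMk (differentiableAt_const _)
        refine DifferentiableAt.comp (g := Φ) (v i) ?_ h3
        simpa using h1
      rcases min_le_iff.1 (hmin v (hbox n v hv) (s' n) (hs' n)) with h | h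
      · exact ⟨0, _, h, (hpd 0).hasDerivAt⟩
      · exact ⟨1, _, h, (hpd 1).hasDerivAt⟩
  choose v hvbox hvface hvle using hstep
  have hvmem : ∀ n, v n ∈ {v ∈ Icc t w | ∃ i, v i = w i} := fun n =>
    ⟨⟨fun i => (htt' n i).le.trans ((hvbox n).1 i), (hvbox n).2⟩, hvface n⟩
  -- The upper faces of the box from `t` to `w` are compact, so the limit also has a coordinate
  -- equal to that of `w` and does not collapse to `t`.
  obtain ⟨x, ⟨hx, hxface⟩, ψ, hψ, hlim⟩ := (isCompact_upperFaces t w).tendsto_subseq hvmem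
  have hwE : w ∈ E := hE.out ht hu ⟨fun i => (htw i).le, fun i => (hwu i).le⟩
  have hsub : ∀ y ∈ Icc t w, y ∈ E := fun y hy => hE.out ht hwE hy
  have hlimit : ∀ {y : Fin 2 → ℝ} {y' : ℕ → Fin 2 → ℝ}, y ∈ E → (∀ n, y' n ∈ E) →
      Tendsto y' atTop (𝓝 y) →
      Tendsto (fun n => Φ (y' n, s' (ψ n))) atTop (𝓝 (Φ (y, s))) := by
    intro y y' hy hy' hlim
    refine (hΦ.continuousOn (y, s) ⟨hy, hs⟩).tendsto.comp (tendsto_nhdsWithin_iff.2 ⟨?_, ?_⟩)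
    · exact hlim.prodMk_nhds (hs'lim.comp hψ.tendsto_atTop)
    · exact Eventually.of_forall fun n => ⟨hy' n, interior_subset (hs' _)⟩
  refine ⟨x, hsub x hx, hx.1, ?_, ?_⟩
  · obtain ⟨i, hi⟩ := hxface
    exact ⟨i, hi ▸ htw i⟩
  · refine le_of_tendsto_of_tendsto' (hlimit (hsub x hx) (fun n => hsub _ (hvmem _).1) hlim)
      (hlimit (y' := t' ∘ ψ) ht (fun n => ?_) (ht'lim.comp hψ.tendsto_atTop)) fun n => hvle (ψ n)
    exact hsub _ ⟨fun i => (htt' _ i).le, fun i => (ht'w _ i).le⟩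

end CherryPick

/-! ### Convex geometry of the IPS and its Pareto frontier. -/

namespace CherryPick

noncomputable section

/-- A convex set in the plane is convex along coordinate lines. -/
lemma mem_of_between {E : Set (Fin 2 → ℝ)} (hE : Convex ℝ E) {i j : Fin 2} (hij : i ≠ j)
    {a b v : Fin 2 → ℝ} (ha : a ∈ E) (hb : b ∈ E) (hai : a i = v i) (hbi : b i = v i)
    (haj : a j ≤ v j) (hbj : v j ≤ b j) : v ∈ E := by
  have hext : ∀ {x : Fin 2 → ℝ}, x i = v i → x j = v j → x = v := by
    intro x hx hx'
    funext k
    have : k = i ∨ k = j := by lia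
    rcases this with rfl | rfl
    · exact hx
    · exact hx'
  have hseg : v j ∈ segment ℝ (a j) (b j) := by
    rw [segment_eq_Icc (haj.trans hbj)]
    exact ⟨haj, hbj⟩
  obtain ⟨p, q, hp, hq, hpq, h⟩ := hseg
  have := hE ha hb hp hq hpq
  rwa [hext (x := p • a + q • b) ?_ h] at this
  change p * a i + q * b i = v i
  rw [hai, hbi, ← add_mul, hpq, one_mul]

namespace Problem

variable {P : Problem.{u}}

lemma convex_IPS : Convex ℝ P.IPS := by
  rintro _ ⟨d, rfl⟩ _ ⟨e, rfl⟩ a b ha hb hab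
  let g : P.carrier → ℝ := fun x => a * Decision.accept d x + b * Decision.accept e x
  have hg : Measurable g :=
    ((measurable_accept d).const_mul a).add ((measurable_accept e).const_mul b)
  have hacc : ∀ x, Decision.accept (P.decisionOf g hg) x = g x := fun x =>
    accept_decisionOf hg (convex_Icc (0 : ℝ) 1 (accept_mem d x) (accept_mem e x) ha hb hab)
  have h1 : ∫ x, Decision.accept (P.decisionOf g hg) x ∂P.μ =
      a * ∫ x, Decision.accept d x ∂P.μ + b * ∫ x, Decision.accept e x ∂P.μ := by
    simp only [hacc, g]
    rw [integral_add ((integrable_accept d).const_mul a) ((integrable_accept e).const_mul b),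
      integral_const_mul, integral_const_mul]
  have h2 : P.rates (P.decisionOf g hg) 1 = a * P.rates d 1 + b * P.rates e 1 := by
    simp only [rates_one, hacc, g, add_mul, mul_assoc]
    rw [integral_add ((integrable_accept_mul_score d).const_mul a)
      ((integrable_accept_mul_score e).const_mul b), integral_const_mul, integral_const_mul]
  refine ⟨P.decisionOf g hg, ?_⟩
  funext i
  fin_cases i
  · change P.rates (P.decisionOf g hg) 0 = a * P.rates d 0 + b * P.rates e 0
    rw [rates_zero', rates_zero', rates_zero', h1, h2]
    linear_combination -(1 - ∫ x, P.score x ∂P.μ) * hab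
  · exact h2

/-- The decision that always chooses one label maximises one rate and annihilates the other. -/
lemma exists_corner {i j : Fin 2} (hij : i ≠ j) : ∃ c ∈ P.IPS, c i = 0 ∧
    (∀ t ∈ P.IPS, t j ≤ c j) ∧ ∀ t ∈ P.IPS, c j ≤ t j → t i = 0 := by
  have h1 : P.rates (P.threshold 1) 1 = 0 := by
    have h0 : ∀ x, Decision.accept (P.threshold 1) x = 0 := by
      intro x
      rw [accept_threshold]
      have : ¬ 1 < P.score x := not_lt.2 (score_mem x).2
      simp [this]
    simp [rates_one, h0]
  have h0 : P.rates (P.threshold 0) 0 = 0 := by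
    rw [rates_zero]
    apply integral_eq_zero_of_ae
    filter_upwards [ae_score_ne 0] with x hx
    have : 0 < P.score x := lt_of_le_of_ne (score_mem x).1 hx.symm
    rw [accept_threshold]
    simp [this]
  have : (i = 1 ∧ j = 0) ∨ (i = 0 ∧ j = 1) := by lia
  rcases this with ⟨rfl, rfl⟩ | ⟨rfl, rfl⟩
  · refine ⟨_, ⟨P.threshold 1, rfl⟩, h1, ?_, ?_⟩
    · rintro _ ⟨d, rfl⟩
      simpa using weighted_rates_le_threshold d 1
    · rintro _ ⟨d, rfl⟩ h
      rw [rates_congr_ae (ae_eq_threshold_of_le (c := 1) (by simpa using h)), h1]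
  · refine ⟨_, ⟨P.threshold 0, rfl⟩, h0, ?_, ?_⟩
    · rintro _ ⟨d, rfl⟩
      simpa using weighted_rates_le_threshold d 0
    · rintro _ ⟨d, rfl⟩ h
      rw [rates_congr_ae (ae_eq_threshold_of_le (c := 0) (by simpa using h)), h0]

lemma nonneg_of_mem_IPS {t : Fin 2 → ℝ} (ht : t ∈ P.IPS) (i : Fin 2) : 0 ≤ t i := by
  obtain ⟨d, rfl⟩ := ht
  exact rates_nonneg d i

/-- The corner of the box spanned by `t ≤ u` that agrees with `t` in the coordinate `i`. -/
lemma boxCorner_mem_IPS {t u v : Fin 2 → ℝ} {i j : Fin 2} (hij : i ≠ j) (ht : t ∈ P.IPS)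
    (hu : u ∈ P.IPS) (htu : t ≤ u) (hvi : v i = t i) (hvj : v j = u j) : v ∈ P.IPS := by
  obtain ⟨c, hc, hci, hcj, -⟩ := exists_corner (P := P) hij
  -- The segment from the corner `c` to `u` has a point with `i`-th coordinate `t i`. Its `j`-th
  -- coordinate is at least `u j` because `c j` is maximal, so `v` lies between `t` and that point.
  have hseg : t i ∈ segment ℝ (c i) (u i) := by
    rw [segment_eq_Icc (by rw [hci]; exact nonneg_of_mem_IPS hu i), hci]
    exact ⟨nonneg_of_mem_IPS ht i, htu i⟩
  obtain ⟨p, q, hp, hq, hpq, h⟩ := hseg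
  refine mem_of_between convex_IPS hij ht (convex_IPS hc hu hp hq hpq) hvi.symm
    (h.trans hvi.symm) ((htu j).trans hvj.ge) ?_
  rw [hvj]
  change u j ≤ p * c j + q * u j
  calc u j = p * u j + q * u j := by rw [← add_mul, hpq, one_mul]
    _ ≤ p * c j + q * u j := by gcongr; exact hcj u hu

/-- Convexity alone does not suffice: the two missing corners of the box come from
`boxCorner_mem_IPS`. The box is then filled along its two vertical edges and the horizontal segments
between them. -/
lemma ordConnected_IPS : P.IPS.OrdConnected := by
  refine ⟨fun t ht u hu v hv => ?_⟩
  have htu : t ≤ u := hv.1.trans hv.2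
  have h01 : ![t 0, u 1] ∈ P.IPS := boxCorner_mem_IPS (i := 0) (j := 1) (by decide) ht hu htu rfl rfl
  have h10 : ![u 0, t 1] ∈ P.IPS := boxCorner_mem_IPS (i := 1) (j := 0) (by decide) ht hu htu rfl rfl
  have h0 : ![t 0, v 1] ∈ P.IPS := mem_of_between convex_IPS (i := 0) (j := 1) (by decide) ht h01
    rfl rfl (hv.1 1) (hv.2 1)
  have h1 : ![u 0, v 1] ∈ P.IPS := mem_of_between convex_IPS (i := 0) (j := 1) (by decide) h10 hu
    rfl rfl (hv.1 1) (hv.2 1)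
  exact mem_of_between convex_IPS (i := 1) (j := 0) (by decide) h0 h1 rfl rfl (hv.1 0) (hv.2 0)

/-- If a decision is not Pareto maximal, then both of its rates can be increased at once. -/
lemma exists_gt_of_not_paretoMaximal {d : P.Decision} (h : ¬ P.ParetoMaximal d) :
    ∃ u ∈ P.IPS, ∀ i, P.rates d i < u i := by
  simp only [ParetoMaximal, paretoLE_iff, not_forall] at h
  obtain ⟨d', hle, hnle⟩ := h
  rw [Pi.le_def, not_forall] at hnle
  obtain ⟨i, hi⟩ := hnle
  rw [not_le] at hi
  obtain ⟨j, hij⟩ : ∃ j : Fin 2, i ≠ j := ⟨1 - i, by lia⟩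
  obtain ⟨c, hc, hci, hcj, hc0⟩ := exists_corner (P := P) hij
  have hd' : P.rates d' ∈ P.IPS := mem_range_self d'
  have hpos : 0 < P.rates d' i := (rates_nonneg d i).trans_lt hi
  -- If `d` already attained the maximum of rate `j`, then so would `d'`, forcing the positive rate
  -- `i` of `d'` to vanish.
  have hlt : P.rates d j < c j := by
    refine (hcj _ (mem_range_self d)).lt_of_ne fun heq => ?_
    exact hpos.ne' (hc0 _ hd' (heq ▸ hle j))
  -- Mixing a fraction `ε` of the corner into `d'` costs half of the gain in rate `i` and makes rate
  -- `j` strictly larger than for `d`.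
  set ε : ℝ := (P.rates d' i - P.rates d i) / (2 * P.rates d' i) with hε
  have hεpos : 0 < ε := div_pos (sub_pos.2 hi) (by linarith)
  have hεlt : ε < 1 := by
    rw [hε, div_lt_one (by linarith)]
    linarith [rates_nonneg d i]
  have hεmul : ε * P.rates d' i = (P.rates d' i - P.rates d i) / 2 := by
    rw [hε]; field_simp
  refine ⟨(1 - ε) • P.rates d' + ε • c,
    convex_IPS hd' hc (by linarith) hεpos.le (by ring), fun k => ?_⟩
  have : k = i ∨ k = j := by lia
  change P.rates d k < (1 - ε) * P.rates d' k + ε * c k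
  rcases this with rfl | rfl
  · rw [hci]
    linarith
  · have h1 := mul_lt_mul_of_pos_left hlt hεpos
    have h2 := mul_le_mul_of_nonneg_left (hle k) (by linarith : (0 : ℝ) ≤ 1 - ε)
    linarith

/-- Pareto maximal decisions are almost everywhere threshold decisions. -/
lemma ParetoMaximal.exists_threshold {d : P.Decision} (h : P.ParetoMaximal d) :
    ∃ c, Decision.accept d =ᵐ[P.μ] Decision.accept (P.threshold c) := by
  set s : Set (Fin 2 → ℝ) := {v | ∀ i, P.rates d i < v i} with hs
  have hs_eq : s = Set.pi univ fun i => Ioi (P.rates d i) := by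
    ext v
    simp [hs]
  have hs_open : IsOpen s := by
    rw [hs_eq]
    exact isOpen_set_pi finite_univ fun i _ => isOpen_Ioi
  have hs_conv : Convex ℝ s := by
    rw [hs_eq]
    exact convex_pi fun i _ => convex_Ioi _
  have hdisj : Disjoint s P.IPS := by
    rw [Set.disjoint_left]
    rintro _ hv ⟨d', rfl⟩
    exact (hv 0).not_ge (h d' (fun i => (hv i).le) 0)
  -- Maximality separates the open quadrant above the rates of `d` from the IPS. The normal `(α,
  -- β)`, divided by `α + β < 0`, yields the weights `c` and `1 - c`.
  obtain ⟨φ, w, hφs, hφE⟩ := geometric_hahn_banach_open hs_conv hs_open convex_IPS hdisj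
  set α := φ (Pi.single 0 1) with hα
  set β := φ (Pi.single 1 1) with hβ
  have hφ : ∀ v, φ v = v 0 * α + v 1 * β := by
    intro v
    have : v = v 0 • Pi.single (M := fun _ : Fin 2 => ℝ) 0 1 +
        v 1 • Pi.single (M := fun _ : Fin 2 => ℝ) 1 1 := by
      funext i
      fin_cases i <;> simp
    conv_lhs => rw [this]
    simp [α, β]
  have hmem : ∀ x y : ℝ, 0 < x → 0 < y →
      (P.rates d 0 + x) * α + (P.rates d 1 + y) * β < w := by
    intro x y hx hy
    have := hφs ![P.rates d 0 + x, P.rates d 1 + y] (by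
      intro i
      fin_cases i
      · simpa using hx
      · simpa using hy)
    rwa [hφ] at this
  have hd := hφE _ (mem_range_self d)
  rw [hφ] at hd
  have hneg : ∀ x y : ℝ, 0 < x → 0 < y → x * α + y * β < 0 := fun x y hx hy => by
    linarith [hmem x y hx hy]
  have hsum : α + β < 0 := by simpa using hneg 1 1 one_pos one_pos
  have hle : ∀ v ∈ P.IPS, P.rates d 0 * α + P.rates d 1 * β ≤ v 0 * α + v 1 * β := by
    intro v hv
    have hv' := hφE v hv
    rw [hφ] at hv'
    refine le_trans ?_ hv'
    apply le_of_forall_pos_le_add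
    intro ε hε
    have h1 : 0 < ε / -(α + β) := div_pos hε (by linarith)
    have h2 := hmem _ _ h1 h1
    have h3 : ε / -(α + β) * (α + β) = -ε := by
      have : α + β ≠ 0 := hsum.ne
      field_simp
    linarith
  refine ⟨α / (α + β), ae_eq_threshold_of_le ?_⟩
  have hT := hle _ (mem_range_self (P.threshold (α / (α + β))))
  have hne : α + β ≠ 0 := hsum.ne
  have e : ∀ t : Fin 2 → ℝ, α / (α + β) * t 0 + (1 - α / (α + β)) * t 1 =
      (t 0 * α + t 1 * β) / (α + β) := by
    intro t
    field_simp
    ring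
  rw [e, e]
  exact div_le_div_of_nonpos_of_le hsum.le hT

/-- A fair coin is nowhere a threshold decision, so it is not Pareto maximal, and an open box lies
above its rates. -/
lemma interior_IPS_nonempty : (interior P.IPS).Nonempty := by
  let d := P.decisionOf (fun _ => 1 / 2) measurable_const
  have hd : ∀ x, Decision.accept d x = 1 / 2 := fun x =>
    accept_decisionOf (g := fun _ => 1 / 2) measurable_const (by norm_num)
  have hnot : ¬ P.ParetoMaximal d := by
    intro h
    obtain ⟨c, hc⟩ := h.exists_threshold
    obtain ⟨x, hx⟩ := hc.exists
    rw [hd, accept_threshold] at hx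
    by_cases h : c < P.score x <;> simp [h] at hx
  obtain ⟨u, hu, hlt⟩ := exists_gt_of_not_paretoMaximal hnot
  refine ⟨fun i => (P.rates d i + u i) / 2,
    box_subset_interior ordConnected_IPS (mem_range_self d) hu fun i => ⟨?_, ?_⟩⟩
  · linarith [hlt i]
  · linarith [hlt i]

lemma rates_restrict (d : P.Decision) (A : Set P.carrier) (hA : MeasurableSet A)
    (h0 : P.μ A ≠ 0) (i : Fin 2) :
    P.μ.real A * (P.restrict A hA h0).rates (P.restrictDecision d A hA h0) i =
      ∫ x in A, (d.1 x : Fin 2 → ℝ) i * (P.p x : Fin 2 → ℝ) i ∂P.μ := by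
  have h1 : (P.restrict A hA h0).rates (P.restrictDecision d A hA h0) i =
      ∫ x in A, (d.1 x : Fin 2 → ℝ) i * (P.p x : Fin 2 → ℝ) i ∂(ProbabilityTheory.cond P.μ A) :=
    integral_subtype_comap hA fun x => (d.1 x : Fin 2 → ℝ) i * (P.p x : Fin 2 → ℝ) i
  have h2 : P.μ.real A ≠ 0 := (measureReal_ne_zero_iff (measure_ne_top _ _)).2 h0
  rw [h1, ProbabilityTheory.cond, Measure.restrict_smul, Measure.restrict_restrict hA, inter_self,
    integral_smul_measure, ENNReal.toReal_inv, smul_eq_mul]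
  exact mul_inv_cancel_left₀ h2 _

end Problem

/-! ### Cherry-picking, and passage between the population and its groups. -/

instance (q : Simplex) : IsFiniteMeasure (labelLaw q) := by
  unfold labelLaw
  have (i : Fin 2) : IsFiniteMeasure
      (ENNReal.ofReal ((q : Fin 2 → ℝ) i) • Measure.dirac i : Measure (Fin 2)) :=
    Measure.smul_finite _ ENNReal.ofReal_ne_top
  infer_instance

lemma labelLaw_singleton (q : Simplex) (i : Fin 2) :
    labelLaw q {i} = ENNReal.ofReal ((q : Fin 2 → ℝ) i) := by
  fin_cases i <;> simp [labelLaw]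

namespace SensitiveGroups

/-- For a threshold decision, if `x` is accepted then so is every `x'` of at least the same score,
and rejecting `x'` is a null event; if `x` is rejected, the conditioning event is null. -/
lemma noCherryPickOn_of_paretoMaximal {Q : Problem.{u}} {d : Q.Decision}
    (h : Q.ParetoMaximal d) : NoCherryPickOn Q d := by
  obtain ⟨c, hc⟩ := h.exists_threshold
  unfold NoCherryPickOn
  filter_upwards [Measure.quasiMeasurePreserving_fst.ae hc,
    Measure.quasiMeasurePreserving_snd.ae hc] with z h1 h2 hle
  rw [Problem.accept_threshold] at h1 h2
  by_cases hz : c < Q.score z.1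
  · have hz' : c < Q.score z.2 := hz.trans_le hle
    apply ProbabilityTheory.cond_absolutelyContinuous
    have hset : {y : Fin 2 × Fin 2 | y.2 = 0} = univ ×ˢ {0} := by
      ext y
      simp
    have h0 : ((d.1 z.2 : Fin 2 → ℝ) 0) = 0 := by
      have h2' : (d.1 z.2 : Fin 2 → ℝ) 1 = 1 := by
        simpa [hz', Problem.Decision.accept] using h2
      rw [simplex_zero_eq, h2', sub_self]
    rw [hset, Measure.prod_prod, labelLaw_singleton, h0]
    simp
  · have hset : {y : Fin 2 × Fin 2 | y.1 = 1} = {1} ×ˢ univ := by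
      ext y
      simp
    have h0 : ((d.1 z.1 : Fin 2 → ℝ) 1) = 0 := by
      simpa [hz, Problem.Decision.accept] using h1
    rw [ProbabilityTheory.cond_eq_zero_of_meas_eq_zero]
    · rfl
    · rw [hset, Measure.prod_prod, labelLaw_singleton, h0]
      simp

variable {P : Problem.{u}} (G : SensitiveGroups P)

/-- Because both weights are positive, raising the rates of one group and keeping those of the other
is a strict improvement on the population. -/
lemma rates_eq (d : P.Decision) : P.rates d =
    P.μ.real G.F • G.problemF.rates (G.decisionF d) +
      P.μ.real G.M • G.problemM.rates (G.decisionM d) := by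
  funext i
  have hint : Integrable (fun x => (d.1 x : Fin 2 → ℝ) i * (P.p x : Fin 2 → ℝ) i) P.μ := by
    have hmem : ∀ (q : Simplex), (q : Fin 2 → ℝ) i ∈ Icc (0 : ℝ) 1 := fun q =>
      mem_Icc_of_mem_stdSimplex q.2 i
    exact Problem.integrable_of_abs_le (((measurable_simplex_apply i).comp d.2).mul
      ((measurable_simplex_apply i).comp P.measurable_p)) 1 fun x =>
        Problem.abs_le_one_of_mem (Problem.mul_mem_unit (hmem _) (hmem _))
  change ∫ x, (d.1 x : Fin 2 → ℝ) i * (P.p x : Fin 2 → ℝ) i ∂P.μ =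
    P.μ.real G.F * G.problemF.rates (G.decisionF d) i +
      P.μ.real G.M * G.problemM.rates (G.decisionM d) i
  rw [Problem.rates_restrict, Problem.rates_restrict,
    ← setIntegral_union G.disjoint G.measurableSet_M hint.integrableOn hint.integrableOn,
    G.union_eq, setIntegral_univ]

/-- Decisions on the groups are restrictions of a decision on the population. -/
lemma exists_glue (d : G.problemF.Decision) (e : G.problemM.Decision) :
    ∃ g : P.Decision, G.decisionF g = d ∧ G.decisionM g = e := by
  classical
  have hM : ∀ x, x ∈ G.Fᶜ → x ∈ G.M := fun x hx =>
    ((G.union_eq ▸ mem_univ x : x ∈ G.F ∪ G.M)).resolve_left hx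
  have hF : ∀ x, x ∈ G.M → x ∉ G.F := fun x hx hx' => Set.disjoint_left.1 G.disjoint hx' hx
  let d' : G.F → Simplex := d.1
  let e' : G.M → Simplex := e.1
  have hd' : Measurable d' := d.2
  have he' : Measurable fun x : (G.Fᶜ : Set P.carrier) => e' ⟨x.1, hM x.1 x.2⟩ :=
    Measurable.comp (g := e') e.2 (measurable_subtype_coe.subtype_mk)
  refine ⟨⟨fun x => if hx : x ∈ G.F then d' ⟨x, hx⟩ else e' ⟨x, hM x hx⟩,
    Measurable.dite hd' he' G.measurableSet_F⟩, ?_, ?_⟩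
  · apply Subtype.ext
    funext x
    exact dif_pos x.2
  · apply Subtype.ext
    funext x
    exact dif_neg (hF x.1 x.2)

lemma paretoLE_of_rates_le {d d' : P.Decision}
    (hF : G.problemF.rates (G.decisionF d) ≤ G.problemF.rates (G.decisionF d'))
    (hM : G.problemM.rates (G.decisionM d) ≤ G.problemM.rates (G.decisionM d')) :
    P.ParetoLE d d' := by
  rw [Problem.paretoLE_iff, G.rates_eq, G.rates_eq]
  exact add_le_add (smul_le_smul_of_nonneg_left hF measureReal_nonneg)
    (smul_le_smul_of_nonneg_left hM measureReal_nonneg)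

lemma paretoLT_of_rates_lt {d d' : P.Decision}
    (hF : G.problemF.rates (G.decisionF d) ≤ G.problemF.rates (G.decisionF d'))
    (hM : G.problemM.rates (G.decisionM d) ≤ G.problemM.rates (G.decisionM d'))
    (hlt : ∃ i, G.problemF.rates (G.decisionF d) i < G.problemF.rates (G.decisionF d') i ∨
      G.problemM.rates (G.decisionM d) i < G.problemM.rates (G.decisionM d') i) :
    P.ParetoLT d d' := by
  refine ⟨G.paretoLE_of_rates_le hF hM, fun hle => ?_⟩
  rw [Problem.paretoLE_iff, G.rates_eq, G.rates_eq] at hle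
  obtain ⟨i, hi⟩ := hlt
  have hposF : 0 < P.μ.real G.F :=
    measureReal_nonneg.lt_of_ne' ((measureReal_ne_zero_iff (measure_ne_top _ _)).2
      G.measure_F_ne_zero)
  have hposM : 0 < P.μ.real G.M :=
    measureReal_nonneg.lt_of_ne' ((measureReal_ne_zero_iff (measure_ne_top _ _)).2
      G.measure_M_ne_zero)
  have h := hle i
  simp only [Pi.add_apply, Pi.smul_apply, smul_eq_mul] at h
  have h1 := mul_le_mul_of_nonneg_left (hF i) hposF.le
  have h2 := mul_le_mul_of_nonneg_left (hM i) hposM.le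
  rcases hi with hi | hi
  · linarith [mul_lt_mul_of_pos_left hi hposF]
  · linarith [mul_lt_mul_of_pos_left hi hposM]

end SensitiveGroups

lemma EvaluationMetric.IsContinuous.continuousOn_hat {l : EvaluationMetric.{u}}
    (hl : l.IsContinuous) (P : Problem.{u}) :
    ContinuousOn (fun t => l.hat t P.IPS) P.IPS := by
  rw [Metric.continuousOn_iff]
  intro t ht ε hε
  obtain ⟨δ, hδ, h⟩ := hl P t ht ε hε
  refine ⟨δ, hδ, fun t' ht' hdist => ?_⟩
  rw [Real.dist_eq]
  exact h P t' ht' hdist (by simpa [fnDist] using hδ)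

/-! ### The improvement step and the choice of a maximiser. -/

lemma exists_paretoLT_ofDecision_le {X : Problem.{u}} (G : SensitiveGroups X)
    (f : FairnessMeasure.{u}) (hf : f.IsSmooth)
    (hF : ∀ t ∈ interior G.problemF.IPS, ∀ s ∈ interior G.problemM.IPS,
      min (f.partialF 0 t G.problemF.IPS s G.problemM.IPS)
        (f.partialF 1 t G.problemF.IPS s G.problemM.IPS) ≤ 0)
    (hM : ∀ t ∈ interior G.problemF.IPS, ∀ s ∈ interior G.problemM.IPS,
      min (f.partialM 0 t G.problemF.IPS s G.problemM.IPS)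
        (f.partialM 1 t G.problemF.IPS s G.problemM.IPS) ≤ 0)
    (d : X.Decision) (h : ¬ G.problemF.ParetoMaximal (G.decisionF d) ∨
      ¬ G.problemM.ParetoMaximal (G.decisionM d)) :
    ∃ d' : X.Decision, X.ParetoLT d d' ∧ f.ofDecision G d' ≤ f.ofDecision G d := by
  have hΦ := hf.2 G.problemF G.problemM
  have hdF : G.problemF.rates (G.decisionF d) ∈ G.problemF.IPS := mem_range_self _
  have hdM : G.problemM.rates (G.decisionM d) ∈ G.problemM.IPS := mem_range_self _
  rcases h with h | h
  · obtain ⟨u, hu, hlt⟩ := Problem.exists_gt_of_not_paretoMaximal h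
    obtain ⟨_, ⟨e, rfl⟩, hle, ⟨i, hi⟩, hval⟩ := exists_gt_le_of_min_deriv_nonpos hΦ
      Problem.ordConnected_IPS Problem.convex_IPS Problem.interior_IPS_nonempty hF hdF hu hlt hdM
    obtain ⟨d', hd'F, hd'M⟩ := G.exists_glue e (G.decisionM d)
    refine ⟨d', G.paretoLT_of_rates_lt (by rwa [hd'F]) (by rw [hd'M])
      ⟨i, Or.inl (by rwa [hd'F])⟩, ?_⟩
    simp only [FairnessMeasure.hat_rates] at hval
    rwa [FairnessMeasure.ofDecision, hd'F, hd'M]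
  · obtain ⟨u, hu, hlt⟩ := Problem.exists_gt_of_not_paretoMaximal h
    -- The analytic lemma moves the first factor, so for `M` the roles of the groups are exchanged.
    have hΦ' : ContDiffOn ℝ 1 (fun z : (Fin 2 → ℝ) × (Fin 2 → ℝ) =>
        f.hat z.2 G.problemF.IPS z.1 G.problemM.IPS) (G.problemM.IPS ×ˢ G.problemF.IPS) :=
      hΦ.comp (contDiff_snd.prodMk contDiff_fst).contDiffOn fun z hz => ⟨hz.2, hz.1⟩
    obtain ⟨_, ⟨e, rfl⟩, hle, ⟨i, hi⟩, hval⟩ := exists_gt_le_of_min_deriv_nonpos hΦ'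
      Problem.ordConnected_IPS Problem.convex_IPS Problem.interior_IPS_nonempty
      (fun t ht s hs => hM s hs t ht) hdM hu hlt hdF
    obtain ⟨d', hd'F, hd'M⟩ := G.exists_glue (G.decisionF d) e
    refine ⟨d', G.paretoLT_of_rates_lt (by rw [hd'F]) (by rwa [hd'M])
      ⟨i, Or.inr (by rwa [hd'M])⟩, ?_⟩
    simp only [FairnessMeasure.hat_rates] at hval
    rwa [FairnessMeasure.ofDecision, hd'F, hd'M]

/-- Among the solutions of the fairness problem there is one of maximal accuracy. -/
lemma exists_mem_fairnessArgmax_forall_sum_le {X : Problem.{u}} (G : SensitiveGroups X)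
    (f : FairnessMeasure.{u}) (hf : f.IsSmooth) (l : EvaluationMetric.{u})
    (hl : l.IsContinuous) : ∃ d ∈ fairnessArgmax l f G, ∀ d' ∈ fairnessArgmax l f G,
      ∑ i, X.rates d' i ≤ ∑ i, X.rates d i := by
  let comb : (Fin 2 → ℝ) × (Fin 2 → ℝ) → Fin 2 → ℝ := fun z =>
    X.μ.real G.F • z.1 + X.μ.real G.M • z.2
  have hcomb : Continuous comb := by fun_prop
  let J : (Fin 2 → ℝ) × (Fin 2 → ℝ) → ℝ := fun z =>
    l.hat (comb z) X.IPS - f.hat z.1 G.problemF.IPS z.2 G.problemM.IPS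
  let rates : X.Decision → (Fin 2 → ℝ) × (Fin 2 → ℝ) := fun d =>
    (G.problemF.rates (G.decisionF d), G.problemM.rates (G.decisionM d))
  have hrange : G.problemF.IPS ×ˢ G.problemM.IPS = range rates := by
    apply Subset.antisymm
    · rintro ⟨_, _⟩ ⟨⟨a, rfl⟩, ⟨b, rfl⟩⟩
      obtain ⟨d, rfl, rfl⟩ := G.exists_glue a b
      exact ⟨d, rfl⟩
    · rintro _ ⟨d, rfl⟩
      exact ⟨mem_range_self _, mem_range_self _⟩
  have hcombr : ∀ d, comb (rates d) = X.rates d := fun d => (G.rates_eq d).symm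
  have hJ : ∀ d, J (rates d) = l.eval X d - f.ofDecision G d := fun d => by
    simp only [J, hcombr, l.hat_rates, rates, f.hat_rates]
    rfl
  have hK : IsCompact (range rates) :=
    hrange ▸ Problem.isCompact_IPS.prod Problem.isCompact_IPS
  have hJc : ContinuousOn J (range rates) := by
    apply ContinuousOn.sub
    · refine (hl.continuousOn_hat X).comp hcomb.continuousOn ?_
      rintro _ ⟨d, rfl⟩
      rw [hcombr]
      exact mem_range_self d
    · rw [← hrange]
      exact (hf.2 _ _).continuousOn
  obtain ⟨_, ⟨d₀, rfl⟩, hd₀⟩ := hK.exists_isMaxOn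
    ⟨_, mem_range_self (X.threshold 0)⟩ hJc
  -- This superlevel set consists of the group rates of the maximisers; compactness permits a second
  -- maximisation, of the sum of the rates.
  have hZ : IsCompact (range rates ∩ J ⁻¹' Ici (J (rates d₀))) :=
    hK.of_isClosed_subset (hJc.preimage_isClosed_of_isClosed hK.isClosed isClosed_Ici)
      inter_subset_left
  obtain ⟨_, ⟨⟨d, rfl⟩, hd⟩, hdmax⟩ := hZ.exists_isMaxOn (f := fun z => ∑ i, comb z i)
    ⟨_, mem_range_self d₀, mem_preimage.2 self_mem_Ici⟩ (by fun_prop)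
  have hd' : J (rates d₀) ≤ J (rates d) := hd
  refine ⟨d, fun e => ?_, fun e he => ?_⟩
  · rw [← hJ, ← hJ]
    exact (hd₀ (mem_range_self e)).trans hd'
  · have h1 : J (rates d₀) ≤ J (rates e) := by
      rw [hJ, hJ]
      exact he d₀
    have h2 : ∑ i, comb (rates e) i ≤ ∑ i, comb (rates d) i := hdmax ⟨mem_range_self e, h1⟩
    rwa [hcombr, hcombr] at h2

end

end CherryPick

theorem mainTheorem2 (X : CherryPick.Problem.{u}) (G : CherryPick.SensitiveGroups X)
    (f : CherryPick.FairnessMeasure.{u}) (hf : f.IsSmooth)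
    (hF : ∀ t ∈ interior G.problemF.IPS, ∀ s ∈ interior G.problemM.IPS,
      min (f.partialF 0 t G.problemF.IPS s G.problemM.IPS)
        (f.partialF 1 t G.problemF.IPS s G.problemM.IPS) ≤ 0)
    (hM : ∀ t ∈ interior G.problemF.IPS, ∀ s ∈ interior G.problemM.IPS,
      min (f.partialM 0 t G.problemF.IPS s G.problemM.IPS)
        (f.partialM 1 t G.problemF.IPS s G.problemM.IPS) ≤ 0) :
    (∀ d : X.Decision,
      (¬ G.problemF.ParetoMaximal (G.decisionF d) ∨
        ¬ G.problemM.ParetoMaximal (G.decisionM d)) →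
      ∃ d' : X.Decision, X.ParetoLT d d' ∧ f.ofDecision G d' ≤ f.ofDecision G d) ∧
    (∀ l : CherryPick.EvaluationMetric.{u}, l.IsContinuous →
      ∃ d ∈ CherryPick.fairnessArgmax l f G, G.NoCherryPick d) := by
  have improve := CherryPick.exists_paretoLT_ofDecision_le G f hf hF hM
  refine ⟨improve, fun l hl => ?_⟩
  obtain ⟨d, hd, hmax⟩ := CherryPick.exists_mem_fairnessArgmax_forall_sum_le G f hf l hl
  have hpareto : G.problemF.ParetoMaximal (G.decisionF d) ∧
      G.problemM.ParetoMaximal (G.decisionM d) := by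
    by_contra hnot
    obtain ⟨d', hlt, hle⟩ := improve d (not_and_or.1 hnot)
    -- The improved decision remains a maximiser, since `ℓ` does not fall and `𝓕` does not rise.
    have hd' : d' ∈ CherryPick.fairnessArgmax l f G := fun e =>
      (hd e).trans (sub_le_sub (l.mono X d d' hlt.1) hle)
    have hsum : ∑ i, X.rates d i < ∑ i, X.rates d' i := by
      obtain ⟨i, hi⟩ := not_forall.1 hlt.2
      exact Finset.sum_lt_sum (fun i _ => hlt.1 i) ⟨i, Finset.mem_univ i, not_le.1 hi⟩
    exact (hmax d' hd').not_gt hsum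
  exact ⟨d, hd, CherryPick.SensitiveGroups.noCherryPickOn_of_paretoMaximal hpareto.1,
    CherryPick.SensitiveGroups.noCherryPickOn_of_paretoMaximal hpareto.2⟩
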